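/- Let $\mathcal A$ be an additive monoidal category, with tensor product $\star$ additive in each variable (for instance a $\Bbbk$-linear additive monoidal category) and unit $\mathbb 1$. Let $\varepsilon\colon C\to\mathbb 1$ and $\Delta\colon C\to C\star C$ be morphisms such that $(\mathrm{id}_C\star\varepsilon)\circ\Delta=\mathrm{id}_C$. We omit associators and unitors, and write $\mathrm{id}_k=\mathrm{id}_{C^{\star k}}$, $C^{\star 0}=\mathbb 1$. Put $e_0=\mathrm{id}_{\mathbb 1}$, $e_1=\mathrm{id}_C$, $e_2=\mathrm{id}_2-\Delta\circ(\mathrm{id}_1\star\varepsilon)$ and, for $n\ge 2$, $e_n=(e_2\star\mathrm{id}_{n-2})\circ(\mathrm{id}_1\star e_2\star\mathrm{id}_{n-3})\circ\cdots\circ(\mathrm{id}_{n-2}\star e_2)\in\mathrm{End}(C^{\star n})$. These are idempotents; let $\mathrm{im}\,e_n$ denote the corresponding objects of the Karoubi envelope $\mathbf{Kar}(\mathcal A)$. The morphisms $\delta_n=(\varepsilon\star\mathrm{id}_{n-1})\circ e_n\colon \mathrm{im}\,e_n\to\mathrm{im}\,e_{n-1}$ satisfy $\delta_{n-1}\circ\delta_n=0$.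 Define complexes, with the term $\mathbb 1$ in degree $0$, $$\hat{\mathbf A}_C=(\cdots\xrightarrow{\delta_3}\mathrm{im}\,e_2\xrightarrow{\delta_2}\mathrm{im}\,e_1\xrightarrow{\delta_1}\mathbb 1),\qquad \mathbf A_C=(\cdots\to C^{\star 2}\to C\to\mathbb 1),$$ over $\mathbf{Kar}(\mathcal A)$ and $\mathcal A$ respectively, where the differential of $\mathbf A_C$ is $\varepsilon\colon C\to\mathbb 1$ and $-\sum_{i=0}^{r}(-1)^i\,\mathrm{id}_i\star\varepsilon\star\mathrm{id}_{r-i}\colon C^{\star r+1}\to C^{\star r}$ for $r\ge 1$. Let $\mathbf F=\mathrm{Cone}(\varepsilon)=(C\xrightarrow{\varepsilon}\mathbb 1)$, with $\mathbb 1$ in degree $0$, let $\iota\colon\mathbb 1\to\mathbf F$ be the inclusion of the degree zero chain object, and consider the directed system $\mathbb 1\to\mathbf F\to\mathbf F^{\star 2}\to\cdots$ with maps $\phi_n=\iota\star\mathrm{id}_{\mathbf F}^{\star n}$. For an additive functor $G\colon\mathcal A\to\mathcal B$ to an additive category with countable coproducts (for example the embedding of $\mathcal A$ into a cocompletion), let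 $\mathbf F^{\star\infty}_{G}$ be the homotopy colimit of the image of this system under $G$, that is, the mapping telescope $\mathrm{Cone}\bigl(\mathrm{id}-\mathrm{shift}\colon\coprod_n G(\mathbf F^{\star n})\to\coprod_n G(\mathbf F^{\star n})\bigr)$, a complex over $\mathcal B$. Then: 1. For every $n\ge 0$ there is a homotopy equivalence over $\mathbf{Kar}(\mathcal A)$ $$\mathbf F^{\star n}\simeq(\mathrm{im}\,e_n\xrightarrow{\delta_n}\cdots\xrightarrow{\delta_2}\mathrm{im}\,e_1\xrightarrow{\delta_1}\mathbb 1).$$ 2. For every such $G$, $\mathbf F^{\star\infty}_{G}\simeq G(\hat{\mathbf A}_C)$ over $\mathbf{Kar}(\mathcal B)$, where $G$ is extended to $\mathbf{Kar}(\mathcal A)\to\mathbf{Kar}(\mathcal B)$. 3. If moreover $C$ is counital, i.e. both $\mathrm{id}_C\star\varepsilon$ and $\varepsilon\star\mathrm{id}_C$ admit right inverses, then $\mathbf A_C\simeq\hat{\mathbf A}_C$ over $\mathbf{Kar}(\mathcal A)$, and for every such $G$, $\mathbf F^{\star\infty}_{G}\simeq G(\mathbf A_C)$ over $\mathcal B$.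 -/

import Mathlib

open CategoryTheory CategoryTheory.Limits CategoryTheory.MonoidalCategory
open CategoryTheory.Idempotents

universe v u v' u'

noncomputable section

namespace CounitalPowers

/-! ### Tensor powers of an object with a map to the monoidal unit -/

section Powers

variable {A : Type u} [Category.{v} A] [MonoidalCategory A]

/-- The tensor powers `C^{⋆ n}`, bracketed to the right, with `C^{⋆ 0}` the monoidal unit. -/
abbrev pow (C : A) : ℕ → A
  | 0 => 𝟙_ A
  | n + 1 => C ⊗ pow C n

variable {C : A} (ε : C ⟶ 𝟙_ A)

/-- `ε` is a counit: both `id_C ⋆ ε` and `ε ⋆ id_C` admit right inverses (sections). -/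
def IsCounit : Prop :=
  IsSplitEpi (C ◁ ε) ∧ IsSplitEpi (ε ▷ C)

/-- The morphism `ε ⋆ id : C ⋆ Y ⟶ 𝟙 ⋆ Y ≅ Y`. -/
def counitLeft (Y : A) : C ⊗ Y ⟶ Y := (ε ▷ Y) ≫ (λ_ Y).hom

/-- The morphism `id^{⋆ i} ⋆ ε ⋆ id^{⋆ (n - i)} : C^{⋆ (n + 1)} ⟶ C^{⋆ n}`, for `0 ≤ i ≤ n`. -/
def counitAt : (n : ℕ) → Fin (n + 1) → (pow C (n + 1) ⟶ pow C n)
  | 0, _ => counitLeft ε (pow C 0)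
  | n + 1, i => Fin.cases (counitLeft ε (pow C (n + 1))) (fun j => C ◁ counitAt n j) i

lemma counitAt_zero (n : ℕ) : counitAt ε n 0 = counitLeft ε (pow C n) := by
  cases n <;> rfl

lemma counitAt_succ (n : ℕ) (j : Fin (n + 1)) :
    counitAt ε (n + 1) j.succ = C ◁ counitAt ε n j := rfl

lemma whiskerLeft_counitLeft {Y Z : A} (g : Y ⟶ Z) :
    (C ◁ g) ≫ counitLeft ε Z = counitLeft ε Y ≫ g := by
  simp [counitLeft, whisker_exchange_assoc]

/-- `id_C ⋆ ε ⋆ id_Y`, in two bracketings. -/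
lemma assoc_whiskerLeft_counitLeft (Y : A) :
    (α_ C C Y).hom ≫ (C ◁ counitLeft ε Y) = ((C ◁ ε) ≫ (ρ_ C).hom) ▷ Y := by
  simp [counitLeft]

lemma counitAt_one (n : ℕ) :
    counitAt ε (n + 1) (Fin.succ 0) = C ◁ counitLeft ε (pow C n) := by
  rw [counitAt_succ, counitAt_zero]

end Powers

/-! ### The complex `A_C` -/

section BarComplex

variable {A : Type u} [Category.{v} A] [Preadditive A] [MonoidalCategory A]
  {C : A} (ε : C ⟶ 𝟙_ A)

/-- The alternating sum `∑_{i=0}^n (-1)^i id^{⋆ i} ⋆ ε ⋆ id^{⋆ (n - i)}`. -/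
def altSum (n : ℕ) : pow C (n + 1) ⟶ pow C n :=
  ∑ i : Fin (n + 1), (-1 : ℤ) ^ (i : ℕ) • counitAt ε n i

variable [MonoidalPreadditive A]

lemma altSum_succ (n : ℕ) :
    altSum ε (n + 1) = counitLeft ε (pow C (n + 1)) - (C ◁ altSum ε n : pow C (n + 2) ⟶ pow C (n + 1)) := by
  have h : C ◁ altSum ε n =
      ∑ i : Fin (n + 1), (-1 : ℤ) ^ (i : ℕ) • (C ◁ counitAt ε n i) := by
    change (tensorLeft C).map _ = _
    rw [altSum, Functor.map_sum]
    refine Finset.sum_congr rfl fun i _ => ?_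
    rw [Functor.map_zsmul]
    rfl
  rw [altSum, Fin.sum_univ_succ, h, counitAt_zero, sub_eq_add_neg, ← Finset.sum_neg_distrib]
  congr 1
  · simp
  · refine Finset.sum_congr rfl fun i _ => ?_
    rw [counitAt_succ, Fin.val_succ, pow_succ]
    simp

lemma altSum_comp (n : ℕ) : altSum ε (n + 1) ≫ altSum ε n = 0 := by
  induction n with
  | zero =>
    have h0 : altSum ε 0 = counitLeft ε (pow C 0) := by
      simp [altSum, counitAt]
    rw [altSum_succ, Preadditive.sub_comp, h0, whiskerLeft_counitLeft]
    exact sub_self _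
  | succ n ih =>
    have h1 : (C ◁ altSum ε (n + 1)) ≫ altSum ε (n + 1) =
        counitLeft ε (pow C (n + 1 + 1)) ≫ altSum ε (n + 1) := by
      conv_lhs =>
        arg 2
        rw [altSum_succ ε n]
      rw [Preadditive.comp_sub, whiskerLeft_counitLeft, ← MonoidalCategory.whiskerLeft_comp, ih,
        MonoidalPreadditive.whiskerLeft_zero, sub_zero]
    rw [altSum_succ ε (n + 1), Preadditive.sub_comp, h1, sub_self]

/-- The differential `C^{⋆ (n + 1)} ⟶ C^{⋆ n}` of `A_C`: it is `ε` for `n = 0`, and for `n ≥ 1`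
it is minus the alternating sum (as `A_C` is the cone of the augmented complex `P_C ⟶ 𝟙`). -/
def barD : (n : ℕ) → (pow C (n + 1) ⟶ pow C n)
  | 0 => altSum ε 0
  | n + 1 => -altSum ε (n + 1)

/-- The complex `A_C = (⋯ ⟶ C^{⋆ 2} ⟶ C ⟶ 𝟙)`, with `C^{⋆ n}` in homological degree `n`. -/
def barComplex : ChainComplex A ℕ :=
  ChainComplex.of (pow C) (barD ε) (by
    rintro (_ | n) <;> simp [barD, altSum_comp])

end BarComplex

/-! ### The idempotents `e_n` and the normalized complex -/

section Normalized

variable {A : Type u} [Category.{v} A] [Preadditive A] [MonoidalCategory A]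
  {C : A} (ε : C ⟶ 𝟙_ A) (Δ : C ⟶ C ⊗ C)

/-- `Δ` satisfies the right counit axiom `(id_C ⋆ ε) ∘ Δ = id_C`. -/
def RightCounitAxiom : Prop := Δ ≫ (C ◁ ε) ≫ (ρ_ C).hom = 𝟙 C

/-- `e_2 = id - Δ ∘ (id_C ⋆ ε)`. -/
def eTwo : C ⊗ C ⟶ C ⊗ C := 𝟙 _ - (C ◁ ε) ≫ (ρ_ C).hom ≫ Δ

/-- The endomorphism
`e_n = (e_2 ⋆ id_{n-2}) ∘ (id_1 ⋆ e_2 ⋆ id_{n-3}) ∘ ⋯ ∘ (id_{n-2} ⋆ e_2)` of `C^{⋆ n}`, written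
recursively as `e_n = (e_2 ⋆ id_{n-2}) ∘ (id_1 ⋆ e_{n-1})`; `e_0` and `e_1` are identities. -/
def e : (n : ℕ) → (pow C n ⟶ pow C n)
  | 0 => 𝟙 _
  | 1 => 𝟙 _
  | n + 2 => (C ◁ e (n + 1)) ≫ (α_ C C (pow C n)).inv ≫ (eTwo ε Δ ▷ pow C n) ≫
      (α_ C C (pow C n)).hom

lemma e_succ_succ (n : ℕ) :
    e ε Δ (n + 2) = (C ◁ e ε Δ (n + 1)) ≫ (α_ C C (pow C n)).inv ≫ (eTwo ε Δ ▷ pow C n) ≫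
      (α_ C C (pow C n)).hom := rfl

variable {ε Δ}

lemma eTwo_comp (h : RightCounitAxiom ε Δ) : eTwo ε Δ ≫ (C ◁ ε) ≫ (ρ_ C).hom = 0 := by
  have h' : Δ ≫ (C ◁ ε) ≫ (ρ_ C).hom = 𝟙 C := h
  simp [eTwo, Preadditive.sub_comp, h']

variable [MonoidalPreadditive A]

lemma whiskerLeft_sub' (X : A) {Y Z : A} (f g : Y ⟶ Z) : X ◁ (f - g) = X ◁ f - X ◁ g :=
  (tensorLeft X).map_sub

lemma sub_whiskerRight' {Y Z : A} (f g : Y ⟶ Z) (X : A) : (f - g) ▷ X = f ▷ X - g ▷ X :=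
  (tensorRight X).map_sub

lemma e_comp_counitAt (h : RightCounitAxiom ε Δ) (n : ℕ) (j : Fin (n + 1)) :
    e ε Δ (n + 2) ≫ counitAt ε (n + 1) j.succ = 0 := by
  induction n with
  | zero =>
    obtain rfl : j = 0 := Fin.fin_one_eq_zero j
    rw [counitAt_one, e_succ_succ]
    simp only [Category.assoc]
    erw [assoc_whiskerLeft_counitLeft]
    rw [← comp_whiskerRight, eTwo_comp h, MonoidalPreadditive.zero_whiskerRight]
    simp
  | succ n ih =>
    rw [e_succ_succ]
    refine Fin.cases ?_ (fun k => ?_) j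
    · rw [counitAt_one]
      simp only [Category.assoc]
      erw [assoc_whiskerLeft_counitLeft]
      rw [← comp_whiskerRight, eTwo_comp h, MonoidalPreadditive.zero_whiskerRight]
      simp
    · rw [counitAt_succ, counitAt_succ]
      have h1 : (α_ C C (pow C (n + 1))).hom ≫ (C ◁ C ◁ counitAt ε n k) =
          ((C ⊗ C) ◁ counitAt ε n k) ≫ (α_ C C (pow C n)).hom := by
        simp
      have h2 : (α_ C C (pow C (n + 1))).inv ≫ ((C ⊗ C) ◁ counitAt ε n k) =
          (C ◁ C ◁ counitAt ε n k) ≫ (α_ C C (pow C n)).inv := by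
        simp
      have h3 : (C ◁ e ε Δ (n + 2)) ≫ (C ◁ C ◁ counitAt ε n k) = 0 := by
        rw [← counitAt_succ]
        erw [← MonoidalCategory.whiskerLeft_comp]
        rw [ih k, MonoidalPreadditive.whiskerLeft_zero]
      simp only [Category.assoc]
      erw [h1]
      rw [← whisker_exchange_assoc]
      erw [reassoc_of% h2]
      erw [reassoc_of% h3]
      simp

/-- A morphism killed by all `id ⋆ ⋯ ⋆ ε ⋆ ⋯ ⋆ id` except the leftmost one absorbs `e_n`. -/
lemma absorb_aux (n : ℕ) : ∀ {D E : A} (f : D ⟶ E ⊗ pow C (n + 1)),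
    (∀ j : Fin n, f ≫ (E ◁ counitAt ε n j.succ) = 0) → f ≫ (E ◁ e ε Δ (n + 1)) = f := by
  induction n with
  | zero =>
    intro D E f _
    change f ≫ (E ◁ 𝟙 _) = f
    simp
  | succ n ih =>
    intro D E f hf
    have h1 : f ≫ (E ◁ C ◁ e ε Δ (n + 1)) = f := by
      have := ih (E := E ⊗ C) (f ≫ (α_ E C (pow C (n + 1))).inv) (fun j => by
        have hj := hf j.succ
        rw [counitAt_succ] at hj
        have : (α_ E C (pow C (n + 1))).inv ≫ ((E ⊗ C) ◁ counitAt ε n j.succ) =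
            (E ◁ C ◁ counitAt ε n j.succ) ≫ (α_ E C (pow C n)).inv := by simp
        rw [Category.assoc, this, reassoc_of% hj]
        simp)
      have h2 : (α_ E C (pow C (n + 1))).inv ≫ ((E ⊗ C) ◁ e ε Δ (n + 1)) =
          (E ◁ C ◁ e ε Δ (n + 1)) ≫ (α_ E C (pow C (n + 1))).inv := by simp
      rw [Category.assoc, h2, ← Category.assoc] at this
      exact (cancel_mono (α_ E C (pow C (n + 1))).inv).1 this
    have h3 := hf 0
    rw [counitAt_one] at h3
    have h4 : (α_ C C (pow C n)).inv ≫ (eTwo ε Δ ▷ pow C n) ≫ (α_ C C (pow C n)).hom =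
        𝟙 _ - (C ◁ counitLeft ε (pow C n)) ≫ (Δ ▷ pow C n) ≫ (α_ C C (pow C n)).hom := by
      rw [eTwo, ← Category.assoc (C ◁ ε), sub_whiskerRight',
        comp_whiskerRight, ← assoc_whiskerLeft_counitLeft]
      simp [Preadditive.sub_comp, Preadditive.comp_sub]
    rw [e_succ_succ, h4]
    erw [MonoidalCategory.whiskerLeft_comp]
    erw [reassoc_of% h1]
    rw [whiskerLeft_sub', Preadditive.comp_sub,
      MonoidalCategory.whiskerLeft_comp]
    erw [reassoc_of% h3]
    simp

lemma absorb (n : ℕ) {D : A} (f : D ⟶ pow C (n + 1))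
    (hf : ∀ j : Fin n, f ≫ counitAt ε n j.succ = 0) : f ≫ e ε Δ (n + 1) = f := by
  have := absorb_aux (Δ := Δ) n (E := 𝟙_ A) (f ≫ (λ_ _).inv) (fun j => by
    rw [Category.assoc, ← leftUnitor_inv_naturality, reassoc_of% (hf j)]
    simp)
  rw [Category.assoc, ← leftUnitor_inv_naturality, ← Category.assoc] at this
  exact (cancel_mono _).1 this

lemma e_idem (h : RightCounitAxiom ε Δ) : ∀ n, e ε Δ n ≫ e ε Δ n = e ε Δ n
  | 0 => Category.comp_id _
  | 1 => Category.comp_id _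
  | n + 2 => absorb _ _ (e_comp_counitAt h n)

variable (ε Δ) in
/-- `δ_{n+1} = (ε ⋆ id_n) ∘ e_{n+1}` as a morphism `C^{⋆ (n + 1)} ⟶ C^{⋆ n}`. -/
def delta (n : ℕ) : pow C (n + 1) ⟶ pow C n := e ε Δ (n + 1) ≫ counitAt ε n 0

lemma delta_comp_counitAt (h : RightCounitAxiom ε Δ) (n : ℕ) (j : Fin (n + 1)) :
    delta ε Δ (n + 1) ≫ counitAt ε n j = 0 := by
  rw [delta, counitAt_zero, Category.assoc, ← whiskerLeft_counitLeft, ← counitAt_succ,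
    reassoc_of% (e_comp_counitAt h n j), zero_comp]

lemma e_comp_delta (h : RightCounitAxiom ε Δ) (n : ℕ) :
    e ε Δ (n + 1) ≫ delta ε Δ n = delta ε Δ n := by
  rw [delta, reassoc_of% (e_idem h (n + 1))]

lemma delta_comp_e (h : RightCounitAxiom ε Δ) :
    ∀ n, delta ε Δ n ≫ e ε Δ n = delta ε Δ n
  | 0 => Category.comp_id _
  | n + 1 => absorb _ _ (fun j => delta_comp_counitAt h n j.succ)

lemma delta_comp_delta (h : RightCounitAxiom ε Δ) (n : ℕ) :
    delta ε Δ (n + 1) ≫ delta ε Δ n = 0 := by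
  conv_lhs => rw [delta.eq_def ε Δ n, ← Category.assoc, delta_comp_e h (n + 1)]
  exact delta_comp_counitAt h n 0

/-- The object `im e_n` of the Karoubi envelope. -/
def imE (h : RightCounitAxiom ε Δ) (n : ℕ) : Karoubi A := ⟨pow C n, e ε Δ n, e_idem h n⟩

/-- The morphism `δ_{n+1} : im e_{n+1} ⟶ im e_n` of the Karoubi envelope. -/
def deltaIm (h : RightCounitAxiom ε Δ) (n : ℕ) : imE h (n + 1) ⟶ imE h n :=
  ⟨delta ε Δ n, by
    change e ε Δ (n + 1) ≫ delta ε Δ n ≫ e ε Δ n = delta ε Δ n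
    rw [delta_comp_e h, e_comp_delta h]⟩

/-- The normalized complex `Â_C = (⋯ ⟶ im e_2 ⟶ im e_1 ⟶ 𝟙)` over the Karoubi envelope, with
`im e_n` in homological degree `n`. -/
def normalizedComplex (h : RightCounitAxiom ε Δ) : ChainComplex (Karoubi A) ℕ :=
  ChainComplex.of (imE h) (deltaIm h) (fun n => Karoubi.hom_ext _ _ (delta_comp_delta h n))

/-- The object `im e_k` for `k ≤ n`, and a zero object (the image of the zero idempotent)
for `k > n`. -/
def imETrunc (h : RightCounitAxiom ε Δ) (n k : ℕ) : Karoubi A :=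
  ⟨pow C k, if k ≤ n then e ε Δ k else 0, by split_ifs <;> simp [e_idem h]⟩

variable (ε Δ) in
/-- The morphism `δ_{k+1}` for `k + 1 ≤ n`, and zero for `k + 1 > n`. -/
def deltaTrunc (n k : ℕ) : pow C (k + 1) ⟶ pow C k := if k + 1 ≤ n then delta ε Δ k else 0

lemma deltaTrunc_comm (h : RightCounitAxiom ε Δ) (n k : ℕ) :
    (if k + 1 ≤ n then e ε Δ (k + 1) else 0) ≫ deltaTrunc ε Δ n k ≫
      (if k ≤ n then e ε Δ k else 0) = deltaTrunc ε Δ n k := by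
  by_cases hk : k + 1 ≤ n
  · have hk' : k ≤ n := by lia
    rw [deltaTrunc, if_pos hk, if_pos hk, if_pos hk', delta_comp_e h, e_comp_delta h]
  · rw [deltaTrunc, if_neg hk, if_neg hk, zero_comp]

lemma deltaTrunc_comp (h : RightCounitAxiom ε Δ) (n k : ℕ) :
    deltaTrunc ε Δ n (k + 1) ≫ deltaTrunc ε Δ n k = 0 := by
  by_cases hk : k + 1 + 1 ≤ n
  · have hk' : k + 1 ≤ n := by lia
    rw [deltaTrunc, deltaTrunc, if_pos hk, if_pos hk', delta_comp_delta h]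
  · rw [deltaTrunc, if_neg hk, zero_comp]

/-- The truncated complex `(im e_n ⟶ ⋯ ⟶ im e_1 ⟶ 𝟙)`, with differentials `δ_k`. -/
def truncatedComplex (h : RightCounitAxiom ε Δ) (n : ℕ) : ChainComplex (Karoubi A) ℕ :=
  ChainComplex.of (imETrunc h n)
    (fun k => ⟨deltaTrunc ε Δ n k, deltaTrunc_comm h n k⟩)
    (fun k => Karoubi.hom_ext _ _ (deltaTrunc_comp h n k))

end Normalized

/-! ### Tensor powers of the cone of `ε` -/

section ConePowers

variable {A : Type u} [Category.{v} A] [Preadditive A] [HasFiniteBiproducts A]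

instance : HasBinaryBiproducts A := hasBinaryBiproducts_of_finite_biproducts A

variable [MonoidalCategory A] {C : A} (ε : C ⟶ 𝟙_ A)

/-- `F = Cone(ε)`, the mapping cone of `ε` between complexes concentrated in degree zero. -/
def cone : ChainComplex A ℕ :=
  HomologicalComplex.homotopyCofiber
    ((HomologicalComplex.single A (ComplexShape.down ℕ) 0).map ε)

variable [MonoidalPreadditive A]

/-- The inclusion `ι : 𝟙 ⟶ F` of the degree zero chain object. -/
def coneι : 𝟙_ (ChainComplex A ℕ) ⟶ cone ε :=
  HomologicalComplex.homotopyCofiber.inr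
    ((HomologicalComplex.single A (ComplexShape.down ℕ) 0).map ε)

/-- The tensor powers `F^{⋆ n}`, with respect to the tensor product of complexes. -/
def conePow (n : ℕ) : ChainComplex A ℕ := pow (cone ε) n

/-- `φ_n = ι ⋆ id_F^{⋆ n} : F^{⋆ n} ≅ 𝟙 ⋆ F^{⋆ n} ⟶ F ⋆ F^{⋆ n} = F^{⋆ (n + 1)}`. -/
def conePowMap (n : ℕ) : conePow ε n ⟶ conePow ε (n + 1) :=
  (λ_ (conePow ε n)).inv ≫ (coneι ε ▷ conePow ε n)

end ConePowers

/-! ### Mapping telescopes -/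

section Telescope

variable {B : Type u'} [Category.{v'} B] [Preadditive B] [HasFiniteBiproducts B]
  [HasCountableCoproducts B]

/-- The mapping telescope (homotopy colimit) of `X 0 ⟶ X 1 ⟶ X 2 ⟶ ⋯`: the mapping cone of
`id - shift : ∐ X n ⟶ ∐ X n`. -/
def telescope (X : ℕ → ChainComplex B ℕ) (φ : ∀ n, X n ⟶ X (n + 1)) : ChainComplex B ℕ :=
  HomologicalComplex.homotopyCofiber
    (𝟙 (∐ X) - Sigma.desc fun n => φ n ≫ Sigma.ι X (n + 1))

variable {A : Type u} [Category.{v} A] [Preadditive A] [HasFiniteBiproducts A]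
  [MonoidalCategory A] [MonoidalPreadditive A] {C : A} (ε : C ⟶ 𝟙_ A)

/-- `F^{⋆ ∞}`: the telescope of `𝟙 ⟶ F ⟶ F^{⋆ 2} ⟶ ⋯`, formed in a category `B` with countable
coproducts to which `A` is mapped by an additive functor `G`. -/
def conePowInfty (G : A ⥤ B) [G.Additive] : ChainComplex B ℕ :=
  telescope (fun n => (G.mapHomologicalComplex _).obj (conePow ε n))
    (fun n => (G.mapHomologicalComplex _).map (conePowMap ε n))

end Telescope

/-! ### Passing to Karoubi envelopes -/

section KaroubiFunctors

variable {A : Type u} [Category.{v} A] [Preadditive A]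

/-- A complex over `A` as a complex over the Karoubi envelope of `A`. -/
def toKar (K : ChainComplex A ℕ) : ChainComplex (Karoubi A) ℕ :=
  ((toKaroubi A).mapHomologicalComplex _).obj K

variable {B : Type u'} [Category.{v'} B] [Preadditive B]

instance functorExtension₂_additive (G : A ⥤ B) [G.Additive] :
    ((functorExtension₂ A B).obj G).Additive where
  map_add {_ _ f g} := Karoubi.hom_ext _ _ (G.map_add (f := f.f) (g := g.f))

/-- The action on complexes of the extension `Kar(A) ⥤ Kar(B)` of an additive functor. -/
def karMap (G : A ⥤ B) [G.Additive] (K : ChainComplex (Karoubi A) ℕ) :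
    ChainComplex (Karoubi B) ℕ :=
  (((functorExtension₂ A B).obj G).mapHomologicalComplex _).obj K

end KaroubiFunctors

/-- The relation of homotopy equivalence of complexes. -/
def HEquiv {B : Type u'} [Category.{v'} B] [Preadditive B] (K L : ChainComplex B ℕ) : Prop :=
  Nonempty (HomotopyEquiv K L)

end CounitalPowers

end

open CounitalPowers

/-!
Write `L = C ⋆ -` and `η = ε ⋆ id : L ⟶ 𝟭`. Tensoring a complex `X` with `F = Cone(ε)` gives the
mapping cone of `η : L X ⟶ X` (`coneDataTensor`), and the map `X ⟶ F ⋆ X` induced by `ι` is the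
inclusion of the target of `η`.

*The splitting.* Over the Karoubi envelope `L` extends to a functor `karTensorLeft C`, and the
complex `C ⋆ Â_C` splits (`normalizedSplitting`). Indeed the identities for `e_n`, which come from
`(id ⋆ ε) ∘ Δ = id`, say that `im e_{n+1}` is a direct summand of `C ⋆ im e_n`, that this summand is
the kernel of the differential of `C ⋆ Â_C`, that the differential of `Â_C` is the restriction of
`η` to it, and that `Δ ⋆ id` gives a contracting homotopy.

*Finite powers.* For a complex `M` whose image `L M` is split in this way, a deformation retraction
of `X` onto the truncation of `M` to degrees `≤ n` extends to a deformation retraction of the cone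
of `η : L X ⟶ X` onto the truncation to degrees `≤ n + 1` (`TruncRetract.cone`): the contracting
homotopy of `L M` cancels all of the shifted `L M`, except for the summand `M (n + 1)` in the top
degree. Starting from the unit complex, this gives retractions of all `F^{⋆ n}` onto the truncations
of `Â_C` (`truncRetractConePow`), hence the first part.

*The telescope.* These retractions are strictly compatible with the maps `φ_n`
(`compatibleRetracts_conePow`), in the projections, inclusions and homotopies. For a telescope of
complexes with such retractions the equivalence with `M` and the homotopies can be written down
(`TelescopeData.hEquiv`); in each degree they involve only the telescoping sums of finitely many
shifted copies (`TelescopeData.shiftSum`). All of this is preserved by additive functors, which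
gives the second part.

*The counital case.* A section of `ε ⋆ id_C` gives sections of `ε ⋆ id : C ⋆ Y ⟶ Y` for all objects
`Y` of the form `C ⋆ Y'`. They show that `Hom(Z, A_C)` and `Hom(Z, Â_C)` are exact for every direct
summand `Z` of such an object (`homExact_barComplex`, `homExact_normalizedComplex`). The terms of
both complexes in positive degrees are of this form and the terms in degree zero agree, so the
comparison theorem for relative projective resolutions applies (`hEquiv_of_homExact`). Finally,
the embedding into the Karoubi envelope is fully faithful, so that a homotopy equivalence between
complexes over `B` descends from `Kar(B)` (`hEquiv_of_toKar`).
-/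

noncomputable section

namespace CounitalPowers

/-! ### Presentations of a complex as a mapping cone -/

section ConeData

variable {D : Type u} [Category.{v} D] [Preadditive D]

/-- A presentation of `P` as the mapping cone of a morphism of complexes `f : K ⟶ X`, the complex
`K` being given by its terms and differentials: in positive degrees `P` is a biproduct of `K`
(shifted by one) and `X`, in degree zero it is `X`, the map `inr` is a morphism of complexes, and
the differential on the shifted part is `f` minus the differential of `K`. -/
structure ConeData {K : ℕ → D} (dK : ∀ k, K (k + 1) ⟶ K k) {X : ChainComplex D ℕ}
    (f : ∀ k, K k ⟶ X.X k) (P : ChainComplex D ℕ) where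
  /-- the inclusion of the target of `f` -/
  inr : X ⟶ P
  /-- the inclusion of the shifted source of `f` -/
  inl : ∀ k, K k ⟶ P.X (k + 1)
  /-- the projection to the shifted source of `f` -/
  fst : ∀ k, P.X (k + 1) ⟶ K k
  /-- the projection to the target of `f` -/
  snd : ∀ k, P.X k ⟶ X.X k
  inl_fst : ∀ k, inl k ≫ fst k = 𝟙 _
  inl_snd : ∀ k, inl k ≫ snd (k + 1) = 0
  inr_fst : ∀ k, inr.f (k + 1) ≫ fst k = 0
  inr_snd : ∀ k, inr.f k ≫ snd k = 𝟙 _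
  total_zero : snd 0 ≫ inr.f 0 = 𝟙 _
  total_succ : ∀ k, fst k ≫ inl k + snd (k + 1) ≫ inr.f (k + 1) = 𝟙 _
  inl_d_zero : inl 0 ≫ P.d 1 0 = f 0 ≫ inr.f 0
  inl_d_succ : ∀ k, inl (k + 1) ≫ P.d (k + 2) (k + 1) =
    f (k + 1) ≫ inr.f (k + 1) - dK k ≫ inl k

namespace ConeData

attribute [simp] inl_fst inl_snd inr_fst inr_snd

variable {K : ℕ → D} {dK : ∀ k, K (k + 1) ⟶ K k} {X P : ChainComplex D ℕ}
  {f : ∀ k, K k ⟶ X.X k} (p : ConeData dK f P)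

@[simp]
lemma inl_fst_assoc (k : ℕ) {Z : D} (g : K k ⟶ Z) : p.inl k ≫ p.fst k ≫ g = g := by
  rw [← Category.assoc, p.inl_fst, Category.id_comp]

@[simp]
lemma inl_snd_assoc (k : ℕ) {Z : D} (g : X.X (k + 1) ⟶ Z) :
    p.inl k ≫ p.snd (k + 1) ≫ g = 0 := by
  rw [← Category.assoc, p.inl_snd, zero_comp]

@[simp]
lemma inr_fst_assoc (k : ℕ) {Z : D} (g : K k ⟶ Z) :
    p.inr.f (k + 1) ≫ p.fst k ≫ g = 0 := by
  rw [← Category.assoc, p.inr_fst, zero_comp]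

@[simp]
lemma inr_snd_assoc (k : ℕ) {Z : D} (g : X.X k ⟶ Z) : p.inr.f k ≫ p.snd k ≫ g = g := by
  rw [← Category.assoc, p.inr_snd, Category.id_comp]

lemma inl_d_zero_assoc {Z : D} (g : P.X 0 ⟶ Z) :
    p.inl 0 ≫ P.d 1 0 ≫ g = f 0 ≫ p.inr.f 0 ≫ g := by
  rw [← Category.assoc, p.inl_d_zero, Category.assoc]

lemma inl_d_succ_assoc (k : ℕ) {Z : D} (g : P.X (k + 1) ⟶ Z) :
    p.inl (k + 1) ≫ P.d (k + 2) (k + 1) ≫ g =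
      (f (k + 1) ≫ p.inr.f (k + 1) - dK k ≫ p.inl k) ≫ g := by
  rw [← Category.assoc, p.inl_d_succ]

include p in
lemma hom_ext_zero {Z : D} {u w : P.X 0 ⟶ Z} (h : p.inr.f 0 ≫ u = p.inr.f 0 ≫ w) : u = w := by
  rw [← Category.id_comp u, ← Category.id_comp w, ← p.total_zero, Category.assoc, h,
    Category.assoc]

lemma hom_ext_succ {k : ℕ} {Z : D} {u w : P.X (k + 1) ⟶ Z}
    (hr : p.inr.f (k + 1) ≫ u = p.inr.f (k + 1) ≫ w) (hl : p.inl k ≫ u = p.inl k ≫ w) :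
    u = w := by
  rw [← Category.id_comp u, ← Category.id_comp w, ← p.total_succ k]
  simp only [Preadditive.add_comp, Category.assoc, hr, hl]

end ConeData

open HomologicalComplex in
/-- The homotopy cofiber of `f` is presented as the cone of `f`. -/
def coneDataHomotopyCofiber {K X : ChainComplex D ℕ} (f : K ⟶ X) [HasHomotopyCofiber f] :
    ConeData (fun k => K.d (k + 1) k) f.f (homotopyCofiber f) where
  inr := homotopyCofiber.inr f
  inl k := homotopyCofiber.inlX f k (k + 1) rfl
  fst k := homotopyCofiber.fstX f (k + 1) k rfl
  snd k := homotopyCofiber.sndX f k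
  inl_fst k := homotopyCofiber.inlX_fstX f _ _ rfl
  inl_snd k := homotopyCofiber.inlX_sndX f _ _ rfl
  inr_fst k := homotopyCofiber.inrX_fstX f _ _ rfl
  inr_snd k := homotopyCofiber.inrX_sndX f _
  total_zero := homotopyCofiber.sndX_inrX f 0 (by simp)
  total_succ k := by
    refine homotopyCofiber.ext_from_X f k (k + 1) rfl ?_ ?_
    · refine (Preadditive.comp_add _ _ _ _ _ _).trans ?_
      erw [homotopyCofiber.inlX_fstX_assoc, homotopyCofiber.inlX_sndX_assoc]
      simp
    · refine (Preadditive.comp_add _ _ _ _ _ _).trans ?_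
      erw [homotopyCofiber.inrX_fstX_assoc, homotopyCofiber.inrX_sndX_assoc]
      simp
  inl_d_zero := homotopyCofiber.inlX_d' f 1 0 rfl (by simp)
  inl_d_succ k :=
    (homotopyCofiber.inlX_d f (k + 2) (k + 1) k rfl rfl).trans (neg_add_eq_sub _ _)

end ConeData

/-! ### Tensoring with the cone of `ε` -/

section TensorCone

variable {A : Type u} [Category.{v} A] [Preadditive A] [HasFiniteBiproducts A]
  [MonoidalCategory A] [MonoidalPreadditive A] {C : A} (ε : C ⟶ 𝟙_ A)

open HomologicalComplex

/-- The cone of `ε` is presented as a cone, with the terms of the complexes concentrated in degree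
zero that occur in its definition. -/
def coneDataCone : ConeData
    (fun k => ((single A (ComplexShape.down ℕ) 0).obj C).d (k + 1) k)
    ((single A (ComplexShape.down ℕ) 0).map ε).f (cone ε) :=
  coneDataHomotopyCofiber _

/-- The degree zero term of the cone of `ε` is the monoidal unit. -/
def coneXZero : 𝟙_ A ≅ (cone ε).X 0 :=
  (singleObjXSelf (ComplexShape.down ℕ) 0 (𝟙_ A)).symm ≪≫
    { hom := (coneDataCone ε).inr.f 0
      inv := (coneDataCone ε).snd 0
      hom_inv_id := (coneDataCone ε).inr_snd 0
      inv_hom_id := (coneDataCone ε).total_zero }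

/-- The degree one term of the cone of `ε` is `C`. -/
def coneXOne : C ≅ (cone ε).X 1 :=
  (singleObjXSelf (ComplexShape.down ℕ) 0 C).symm ≪≫
    { hom := (coneDataCone ε).inl 0
      inv := (coneDataCone ε).fst 0
      hom_inv_id := (coneDataCone ε).inl_fst 0
      inv_hom_id := by
        have h0 : (coneDataCone ε).snd 1 = 0 :=
          (isZero_single_obj_X _ _ _ _ (by simp)).eq_of_tgt _ _
        have := (coneDataCone ε).total_succ 0
        rwa [h0, zero_comp, add_zero] at this }

omit [MonoidalPreadditive A] in
lemma coneXOne_hom_d : (coneXOne ε).hom ≫ (cone ε).d 1 0 = ε ≫ (coneXZero ε).hom := by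
  simp only [coneXOne, coneXZero, Iso.trans_hom, Iso.symm_hom, Category.assoc]
  rw [(coneDataCone ε).inl_d_zero, single_map_f_self]
  simp only [Category.assoc, Iso.inv_hom_id_assoc]

omit [MonoidalPreadditive A] in
lemma isZero_cone_X (k : ℕ) : IsZero ((cone ε).X (k + 2)) := by
  have h0 : (coneDataCone ε).snd (k + 2) = 0 :=
    (isZero_single_obj_X _ _ _ _ (by simp)).eq_of_tgt _ _
  have h1 : (coneDataCone ε).fst (k + 1) = 0 :=
    (isZero_single_obj_X _ _ _ _ (by simp)).eq_of_tgt _ _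
  have := (coneDataCone ε).total_succ (k + 1)
  rw [h0, h1, zero_comp, zero_comp, add_zero] at this
  exact (IsZero.iff_id_eq_zero _).2 this.symm

/-- The components of the inclusion of `X` in `F ⋆ X`. -/
lemma conePowMap_f (X : ChainComplex A ℕ) (k : ℕ) :
    ((λ_ X).inv ≫ (coneι ε ▷ X)).f k =
      (λ_ (X.X k)).inv ≫ ((coneXZero ε).hom ▷ X.X k) ≫
        ιTensorObj (cone ε) X 0 k k (zero_add k) := by
  have h1 : (λ_ X).inv.f k = (leftUnitor' X).inv k := rfl
  rw [comp_f, h1, leftUnitor'_inv, coneXZero]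
  simp only [Category.assoc, Iso.trans_hom, Iso.symm_hom, comp_whiskerRight]
  congr 2
  erw [ι_mapBifunctorMap]
  simp
  refine congrArg₂ (· ≫ ·) ?_ rfl
  have : (coneι ε).f 0 = (coneDataCone ε).inr.f 0 := rfl
  rw [← this]
  rfl

variable (X : ChainComplex A ℕ)

variable {X} in
lemma tensorCone_hom_ext {k : ℕ} {Z : A} {u w : (HomologicalComplex.tensorObj (cone ε) X).X k ⟶ Z}
    (h0 : ιTensorObj (cone ε) X 0 k k (zero_add k) ≫ u =
      ιTensorObj (cone ε) X 0 k k (zero_add k) ≫ w)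
    (h1 : ∀ j (h : 1 + j = k), ιTensorObj (cone ε) X 1 j k h ≫ u =
      ιTensorObj (cone ε) X 1 j k h ≫ w) : u = w := by
  apply mapBifunctor.hom_ext
  rintro (_ | _ | i) j h
  · obtain rfl : j = k := (zero_add j).symm.trans h
    exact h0
  · exact h1 j h
  · refine IsZero.eq_of_src ?_ _ _
    exact (tensorRight (X.X j)).map_isZero (isZero_cone_X ε i)

lemma ι_one_d_zero :
    ιTensorObj (cone ε) X 1 0 1 rfl ≫ (HomologicalComplex.tensorObj (cone ε) X).d 1 0 =
      ((cone ε).d 1 0 ▷ X.X 0) ≫ ιTensorObj (cone ε) X 0 0 0 (zero_add _) := by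
  rw [mapBifunctor.d_eq, Preadditive.comp_add, mapBifunctor.ι_D₁, mapBifunctor.ι_D₂,
    mapBifunctor.d₂_eq_zero _ _ _ _ _ _ _ (by simp), add_zero,
    mapBifunctor.d₁_eq _ _ _ _ (show (ComplexShape.down ℕ).Rel 1 0 from rfl) _ _ (zero_add _)]
  exact one_smul _ _

lemma ι_one_d_succ (k : ℕ) :
    ιTensorObj (cone ε) X 1 (k + 1) (k + 2) (add_comm _ _) ≫
        (HomologicalComplex.tensorObj (cone ε) X).d (k + 2) (k + 1) =
      ((cone ε).d 1 0 ▷ X.X (k + 1)) ≫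
        ιTensorObj (cone ε) X 0 (k + 1) (k + 1) (zero_add _) -
      ((cone ε).X 1 ◁ X.d (k + 1) k) ≫ ιTensorObj (cone ε) X 1 k (k + 1) (add_comm _ _) := by
  rw [mapBifunctor.d_eq, Preadditive.comp_add, mapBifunctor.ι_D₁, mapBifunctor.ι_D₂,
    mapBifunctor.d₂_eq _ _ _ _ 1 (show (ComplexShape.down ℕ).Rel (k + 1) k from rfl) (k + 1)
      (add_comm _ _),
    mapBifunctor.d₁_eq _ _ _ _ (show (ComplexShape.down ℕ).Rel 1 0 from rfl) _ _ (zero_add _),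
    sub_eq_add_neg]
  refine congrArg₂ (· + ·) (one_smul _ _) ?_
  have : ComplexShape.ε₂ (ComplexShape.down ℕ) (ComplexShape.down ℕ) (ComplexShape.down ℕ)
      (1, k + 1) = -1 := by
    simp
  rw [this, Units.neg_smul, one_smul]
  rfl

/-- The tensor product of the cone of `ε` with `X` is presented as the cone of
`ε ⋆ id : C ⋆ X ⟶ X`. -/
def coneDataTensor : ConeData (K := fun k => C ⊗ X.X k) (fun k => C ◁ X.d (k + 1) k)
    (fun k => counitLeft ε (X.X k)) (cone ε ⊗ X) where
  inr := (λ_ X).inv ≫ (coneι ε ▷ X)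
  inl k := ((coneXOne ε).hom ▷ X.X k) ≫ ιTensorObj (cone ε) X 1 k (k + 1) (add_comm _ _)
  fst k := mapBifunctorDesc (K₁ := cone ε) (K₂ := X) (F := curriedTensor A) fun i j h =>
    match i, h with
    | 0, _ => 0
    | 1, h => ((coneXOne ε).inv ▷ X.X j) ≫
        (C ◁ (X.XIsoOfEq (show j = k from Nat.succ_injective ((add_comm j 1).trans h))).hom)
    | _ + 2, _ => 0
  snd k := mapBifunctorDesc (K₁ := cone ε) (K₂ := X) (F := curriedTensor A) fun i j h =>
    match i, h with
    | 0, h => ((coneXZero ε).inv ▷ X.X j) ≫ (λ_ (X.X j)).hom ≫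
        (X.XIsoOfEq (show j = k from (zero_add j).symm.trans h)).hom
    | _ + 1, _ => 0
  inl_fst k := by
    rw [Category.assoc]
    erw [ι_mapBifunctorDesc]
    simp
  inl_snd k := by
    rw [Category.assoc]
    erw [ι_mapBifunctorDesc]
    simp
  inr_fst k := by
    rw [conePowMap_f]
    simp only [Category.assoc]
    erw [ι_mapBifunctorDesc]
    simp
  inr_snd k := by
    rw [conePowMap_f]
    simp only [Category.assoc]
    erw [ι_mapBifunctorDesc]
    simp
  total_zero := by
    refine tensorCone_hom_ext ε ?_ (fun j h => by lia)
    rw [conePowMap_f]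
    erw [ι_mapBifunctorDesc_assoc]
    simp only [Category.assoc]
    simp
    exact (Category.comp_id _).symm
  total_succ k := by
    refine tensorCone_hom_ext ε ?_ (fun j h => ?_)
    · rw [conePowMap_f]
      refine (Preadditive.comp_add _ _ _ _ _ _).trans ?_
      erw [ι_mapBifunctorDesc_assoc, ι_mapBifunctorDesc_assoc]
      simp only [Category.assoc]
      simp
      exact (Category.comp_id _).symm
    · obtain rfl : j = k := by lia
      refine (Preadditive.comp_add _ _ _ _ _ _).trans ?_
      erw [ι_mapBifunctorDesc_assoc, ι_mapBifunctorDesc_assoc]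
      simp only [Category.assoc]
      simp
      exact (Category.comp_id _).symm
  inl_d_zero := by
    rw [conePowMap_f, Category.assoc]
    erw [ι_one_d_zero]
    rw [← comp_whiskerRight_assoc, coneXOne_hom_d]
    simp [counitLeft]
  inl_d_succ k := by
    rw [conePowMap_f, Category.assoc]
    erw [ι_one_d_succ]
    rw [Preadditive.comp_sub, ← comp_whiskerRight_assoc, coneXOne_hom_d]
    simp [counitLeft, whisker_exchange_assoc]

end TensorCone

/-! ### Morphisms and homotopies between chain complexes indexed by `ℕ` -/

section ChainComplexes

variable {D : Type u} [Category.{v} D] [Preadditive D] {P Q : ChainComplex D ℕ}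

/-- A morphism of chain complexes from its components and the commutation with the differentials
`X (k + 1) ⟶ X k`. -/
def homOfSucc (f : ∀ k, P.X k ⟶ Q.X k)
    (hf : ∀ k, f (k + 1) ≫ Q.d (k + 1) k = P.d (k + 1) k ≫ f k) : P ⟶ Q where
  f := f
  comm' i j hij := by
    obtain rfl : j + 1 = i := hij
    exact hf j

/-- A homotopy between morphisms of chain complexes from its components `X k ⟶ Y (k + 1)`. -/
def homotopyOfSucc {f g : P ⟶ Q} (s : ∀ k, P.X k ⟶ Q.X (k + 1))
    (h0 : s 0 ≫ Q.d 1 0 = f.f 0 - g.f 0)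
    (hs : ∀ k, s (k + 1) ≫ Q.d (k + 2) (k + 1) + P.d (k + 1) k ≫ s k =
      f.f (k + 1) - g.f (k + 1)) : Homotopy f g where
  hom i j := if h : i + 1 = j then s i ≫ (Q.XIsoOfEq h).hom else 0
  zero i j hij := dif_neg hij
  comm i := by
    rw [prevD_eq _ (show (ComplexShape.down ℕ).Rel (i + 1) i from rfl)]
    cases i with
    | zero =>
      rw [dNext_eq_zero _ _ (by simp)]
      simp [h0]
    | succ k =>
      rw [dNext_eq _ (show (ComplexShape.down ℕ).Rel (k + 1) k from rfl)]
      have := hs k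
      simp only [dite_true, HomologicalComplex.XIsoOfEq_rfl, Iso.refl_hom, Category.comp_id]
      rw [add_comm (P.d (k + 1) k ≫ s k), hs k, sub_add_cancel]

end ChainComplexes

/-! ### Truncated deformation retracts and their extension to cones -/

section Retract

variable {D : Type u} [Category.{v} D] [Preadditive D]

/-- A deformation retraction of the complex `X` onto the truncation of the complex `M` to degrees
`≤ n`: the projection `π`, the inclusion `χ` and the homotopy `h` from `𝟙` to `π ≫ χ`. The
components of `π` and `χ` in degrees `> n` are zero. -/
structure TruncRetract (M X : ChainComplex D ℕ) (n : ℕ) where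
  /-- the projection -/
  π : ∀ k, X.X k ⟶ M.X k
  /-- the inclusion -/
  χ : ∀ k, M.X k ⟶ X.X k
  /-- the homotopy -/
  h : ∀ k, X.X k ⟶ X.X (k + 1)
  π_zero : ∀ k, n < k → π k = 0
  χ_zero : ∀ k, n < k → χ k = 0
  π_d : ∀ k, π (k + 1) ≫ M.d (k + 1) k = X.d (k + 1) k ≫ π k
  χ_d : ∀ k, k + 1 ≤ n → χ (k + 1) ≫ X.d (k + 1) k = M.d (k + 1) k ≫ χ k
  χ_π : ∀ k, k ≤ n → χ k ≫ π k = 𝟙 _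
  h_d_zero : h 0 ≫ X.d 1 0 = 𝟙 _ - π 0 ≫ χ 0
  h_d_succ : ∀ k, h (k + 1) ≫ X.d (k + 2) (k + 1) + X.d (k + 1) k ≫ h k =
    𝟙 _ - π (k + 1) ≫ χ (k + 1)

/-- The image of a retraction under an additive functor. -/
def TruncRetract.map {D' : Type u'} [Category.{v'} D'] [Preadditive D'] (G : D ⥤ D') [G.Additive]
    {M X : ChainComplex D ℕ} {n : ℕ} (r : TruncRetract M X n) :
    TruncRetract ((G.mapHomologicalComplex _).obj M) ((G.mapHomologicalComplex _).obj X) n where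
  π k := G.map (r.π k)
  χ k := G.map (r.χ k)
  h k := G.map (r.h k)
  π_zero k hk := by rw [r.π_zero k hk]; exact G.map_zero _ _
  χ_zero k hk := by rw [r.χ_zero k hk]; exact G.map_zero _ _
  π_d k := (G.map_comp _ _).symm.trans ((congrArg G.map (r.π_d k)).trans (G.map_comp _ _))
  χ_d k hk := (G.map_comp _ _).symm.trans ((congrArg G.map (r.χ_d k hk)).trans (G.map_comp _ _))
  χ_π k hk := (G.map_comp _ _).symm.trans ((congrArg G.map (r.χ_π k hk)).trans (G.map_id _))
  h_d_zero := by
    have := congrArg G.map r.h_d_zero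
    rw [G.map_sub, G.map_comp, G.map_comp, G.map_id] at this
    exact this
  h_d_succ k := by
    have := congrArg G.map (r.h_d_succ k)
    rw [G.map_sub, G.map_add, G.map_comp, G.map_comp, G.map_comp, G.map_id] at this
    exact this

/-- An explicit splitting of the complex `L M`, for an endofunctor `L` with a natural
transformation `η : L ⟶ 𝟭`: the object `M (k + 1)` is, via `j` and `q`, the direct summand of
`L (M k)` which is the kernel of the differential of `L M`, and `t` is a contracting homotopy of
`L M`. The differential of `M` is the restriction of `η`. -/
structure Splitting (L : D ⥤ D) (η : L ⟶ 𝟭 D) (M : ChainComplex D ℕ) where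
  /-- the inclusion of `M (k + 1)` in `L (M k)` -/
  j : ∀ k, M.X (k + 1) ⟶ L.obj (M.X k)
  /-- the projection of `L (M k)` to `M (k + 1)` -/
  q : ∀ k, L.obj (M.X k) ⟶ M.X (k + 1)
  /-- the contracting homotopy -/
  t : ∀ k, L.obj (M.X k) ⟶ L.obj (M.X (k + 1))
  j_q : ∀ k, j k ≫ q k = 𝟙 _
  j_η : ∀ k, j k ≫ η.app (M.X k) = M.d (k + 1) k
  j_d : ∀ k, j (k + 1) ≫ L.map (M.d (k + 1) k) = 0
  q_j_zero : q 0 ≫ j 0 = 𝟙 _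
  t_d : ∀ k, t k ≫ L.map (M.d (k + 1) k) = q k ≫ j k
  d_t : ∀ k, L.map (M.d (k + 1) k) ≫ t k = 𝟙 _ - q (k + 1) ≫ j (k + 1)

namespace Splitting

variable {L : D ⥤ D} {η : L ⟶ 𝟭 D} {M : ChainComplex D ℕ} (σ : Splitting L η M)

lemma j_η_assoc (k : ℕ) {Z : D} (g : M.X k ⟶ Z) :
    σ.j k ≫ η.app (M.X k) ≫ g = M.d (k + 1) k ≫ g := by
  rw [← σ.j_η, Category.assoc]

lemma j_d_assoc (k : ℕ) {Z : D} (g : L.obj (M.X k) ⟶ Z) :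
    σ.j (k + 1) ≫ L.map (M.d (k + 1) k) ≫ g = 0 := by
  rw [← Category.assoc, σ.j_d, zero_comp]

lemma q_j_zero_assoc {Z : D} (g : L.obj (M.X 0) ⟶ Z) : σ.q 0 ≫ σ.j 0 ≫ g = g := by
  rw [← Category.assoc, σ.q_j_zero, Category.id_comp]

lemma t_d_assoc (k : ℕ) {Z : D} (g : L.obj (M.X k) ⟶ Z) :
    σ.t k ≫ L.map (M.d (k + 1) k) ≫ g = σ.q k ≫ σ.j k ≫ g := by
  rw [← Category.assoc, σ.t_d, Category.assoc]

lemma d_t_assoc (k : ℕ) {Z : D} (g : L.obj (M.X (k + 1)) ⟶ Z) :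
    L.map (M.d (k + 1) k) ≫ σ.t k ≫ g = (𝟙 _ - σ.q (k + 1) ≫ σ.j (k + 1)) ≫ g := by
  rw [← Category.assoc, σ.d_t]

end Splitting

namespace TruncRetract

variable {L : D ⥤ D} [L.Additive] {η : L ⟶ 𝟭 D} {M X P : ChainComplex D ℕ} {n : ℕ}
  (r : TruncRetract M X n) (σ : Splitting L η M)
  (p : ConeData (K := fun k => L.obj (X.X k)) (fun k => L.map (X.d (k + 1) k))
    (fun k => η.app (X.X k)) P)

lemma π_d_assoc (k : ℕ) {Z : D} (g : M.X k ⟶ Z) :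
    r.π (k + 1) ≫ M.d (k + 1) k ≫ g = X.d (k + 1) k ≫ r.π k ≫ g := by
  rw [← Category.assoc, r.π_d, Category.assoc]

lemma χ_π_assoc (k : ℕ) (hk : k ≤ n) {Z : D} (g : M.X k ⟶ Z) : r.χ k ≫ r.π k ≫ g = g := by
  rw [← Category.assoc, r.χ_π k hk, Category.id_comp]

omit [Preadditive D] [L.Additive] in
lemma η_nat {Y Z : D} (g : Y ⟶ Z) : L.map g ≫ η.app Z = η.app Y ≫ g := η.naturality g

variable (n) in
/-- The component `L (M k) ⟶ M (k + 1)` of the projection from the cone of `L X ⟶ X`. For `k = n` it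
is the projection to the new summand `M (n + 1)`. The other values matter only for `k < n`, where
the shifted copy of `L M` is cancelled by means of its contracting homotopy. -/
def coneκ (k : ℕ) : L.obj (M.X k) ⟶ M.X (k + 1) :=
  if k = n then σ.q k else σ.t k ≫ η.app (M.X (k + 1))

omit [L.Additive] in
lemma coneκ_d (k : ℕ) : coneκ n σ k ≫ M.d (k + 1) k = σ.q k ≫ σ.j k ≫ η.app (M.X k) := by
  unfold coneκ
  split_ifs with hk
  · rw [σ.j_η]
  · rw [Category.assoc, ← η_nat, σ.t_d_assoc]

omit [L.Additive] in
lemma d_coneκ {k : ℕ} (hk : k < n) :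
    L.map (M.d (k + 1) k) ≫ coneκ n σ k =
      η.app (M.X (k + 1)) - σ.q (k + 1) ≫ σ.j (k + 1) ≫ η.app (M.X (k + 1)) := by
  rw [coneκ, if_neg hk.ne, σ.d_t_assoc]
  simp [Preadditive.sub_comp]

/-- The projection from the cone of `L X ⟶ X`. -/
def coneπ : ∀ k, P.X k ⟶ M.X k
  | 0 => p.snd 0 ≫ r.π 0
  | k + 1 => p.fst k ≫ L.map (r.π k) ≫ coneκ n σ k + p.snd (k + 1) ≫ r.π (k + 1)

/-- The inclusion in the cone of `L X ⟶ X`: the new top degree `M (n + 1)` is included through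
`L (M n)`, and in the other degrees the inclusion is that in `X`. -/
def coneχ : ∀ k, M.X k ⟶ P.X k
  | 0 => r.χ 0 ≫ p.inr.f 0
  | k + 1 => if k = n then σ.j k ≫ L.map (r.χ k) ≫ p.inl k else r.χ (k + 1) ≫ p.inr.f (k + 1)

/-- The homotopy on the cone of `L X ⟶ X`: the given one on `X` and, on the shifted part, minus the
sum of its image under `L` and of the contracting homotopy of `L M` transported to `L X`. -/
def coneH : ∀ k, P.X k ⟶ P.X (k + 1)
  | 0 => p.snd 0 ≫ r.h 0 ≫ p.inr.f 1
  | k + 1 => p.snd (k + 1) ≫ r.h (k + 1) ≫ p.inr.f (k + 2) -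
      p.fst k ≫ (L.map (r.h k) + L.map (r.π k) ≫ σ.t k ≫ L.map (r.χ (k + 1))) ≫ p.inl (k + 1)

omit [L.Additive] in
@[simp]
lemma inr_coneπ (k : ℕ) : p.inr.f k ≫ r.coneπ σ p k = r.π k := by
  cases k <;> simp [coneπ, Preadditive.comp_add]

omit [L.Additive] in
lemma inr_coneπ_assoc (k : ℕ) {Z : D} (g : M.X k ⟶ Z) :
    p.inr.f k ≫ r.coneπ σ p k ≫ g = r.π k ≫ g := by
  rw [← Category.assoc, inr_coneπ]

omit [L.Additive] in
@[simp]
lemma inl_coneπ (k : ℕ) : p.inl k ≫ r.coneπ σ p (k + 1) = L.map (r.π k) ≫ coneκ n σ k := by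
  simp [coneπ, Preadditive.comp_add]

omit [L.Additive] in
lemma inl_coneπ_assoc (k : ℕ) {Z : D} (g : M.X (k + 1) ⟶ Z) :
    p.inl k ≫ r.coneπ σ p (k + 1) ≫ g = L.map (r.π k) ≫ coneκ n σ k ≫ g := by
  rw [← Category.assoc, inl_coneπ, Category.assoc]

omit [L.Additive] in
@[simp]
lemma inr_coneH (k : ℕ) : p.inr.f k ≫ r.coneH σ p k = r.h k ≫ p.inr.f (k + 1) := by
  cases k <;> simp [coneH, Preadditive.comp_sub]

omit [L.Additive] in
lemma inr_coneH_assoc (k : ℕ) {Z : D} (g : P.X (k + 1) ⟶ Z) :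
    p.inr.f k ≫ r.coneH σ p k ≫ g = r.h k ≫ p.inr.f (k + 1) ≫ g := by
  rw [← Category.assoc, inr_coneH, Category.assoc]

omit [L.Additive] in
@[simp]
lemma inl_coneH (k : ℕ) : p.inl k ≫ r.coneH σ p (k + 1) =
    -((L.map (r.h k) + L.map (r.π k) ≫ σ.t k ≫ L.map (r.χ (k + 1))) ≫ p.inl (k + 1)) := by
  simp [coneH, Preadditive.comp_sub]

omit [L.Additive] in
lemma inl_coneH_assoc (k : ℕ) {Z : D} (g : P.X (k + 2) ⟶ Z) :
    p.inl k ≫ r.coneH σ p (k + 1) ≫ g =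
      (-((L.map (r.h k) + L.map (r.π k) ≫ σ.t k ≫ L.map (r.χ (k + 1))) ≫ p.inl (k + 1))) ≫ g := by
  rw [← Category.assoc, inl_coneH]

omit [L.Additive] in
lemma coneχ_of_le {k : ℕ} (hk : k ≤ n) : r.coneχ σ p k = r.χ k ≫ p.inr.f k := by
  cases k with
  | zero => rfl
  | succ k => rw [coneχ, if_neg (by lia)]

omit [L.Additive] in
lemma coneχ_top : r.coneχ σ p (n + 1) = σ.j n ≫ L.map (r.χ n) ≫ p.inl n := by
  rw [coneχ, if_pos rfl]

lemma coneπ_d (k : ℕ) :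
    r.coneπ σ p (k + 1) ≫ M.d (k + 1) k = P.d (k + 1) k ≫ r.coneπ σ p k := by
  refine p.hom_ext_succ ?_ ?_
  · rw [inr_coneπ_assoc, r.π_d, p.inr.comm_assoc, inr_coneπ]
  · rw [inl_coneπ_assoc, coneκ_d]
    cases k with
    | zero => rw [p.inl_d_zero_assoc, inr_coneπ, σ.q_j_zero_assoc, η_nat]
    | succ k =>
      rw [p.inl_d_succ_assoc, Preadditive.sub_comp, Category.assoc, inr_coneπ, Category.assoc,
        inl_coneπ, ← η_nat, ← L.map_comp_assoc, ← r.π_d, L.map_comp_assoc]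
      by_cases hk : k < n
      · rw [d_coneκ σ hk, Preadditive.comp_sub, sub_sub_cancel]
      · rw [r.π_zero (k + 1) (by lia)]
        simp

omit [L.Additive] in
lemma coneχ_d {k : ℕ} (hk : k + 1 ≤ n + 1) :
    r.coneχ σ p (k + 1) ≫ P.d (k + 1) k = M.d (k + 1) k ≫ r.coneχ σ p k := by
  rw [r.coneχ_of_le σ p (show k ≤ n by lia)]
  obtain hk' | rfl : k + 1 ≤ n ∨ k = n := by lia
  · rw [r.coneχ_of_le σ p hk', Category.assoc, p.inr.comm, ← Category.assoc, r.χ_d k hk',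
      Category.assoc]
  · rw [coneχ_top, Category.assoc, Category.assoc]
    cases k with
    | zero => rw [p.inl_d_zero, ← Category.assoc (L.map _), η_nat, Category.assoc, σ.j_η_assoc]
    | succ k =>
      rw [p.inl_d_succ, Preadditive.comp_sub, ← Category.assoc (L.map _), η_nat, Category.assoc,
        ← L.map_comp_assoc, r.χ_d k le_rfl, L.map_comp_assoc, Preadditive.comp_sub, σ.j_η_assoc,
        σ.j_d_assoc, sub_zero]

omit [L.Additive] in
lemma coneχ_coneπ {k : ℕ} (hk : k ≤ n + 1) : r.coneχ σ p k ≫ r.coneπ σ p k = 𝟙 _ := by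
  obtain hk' | rfl : k ≤ n ∨ k = n + 1 := by lia
  · rw [r.coneχ_of_le σ p hk', Category.assoc, inr_coneπ, r.χ_π k hk']
  · rw [coneχ_top, Category.assoc, Category.assoc, inl_coneπ, ← L.map_comp_assoc, r.χ_π n le_rfl,
      L.map_id, Category.id_comp, coneκ, if_pos rfl, σ.j_q]

lemma coneκ_coneχ (k : ℕ) : coneκ n σ k ≫ r.coneχ σ p (k + 1) =
    σ.t k ≫ η.app (M.X (k + 1)) ≫ r.χ (k + 1) ≫ p.inr.f (k + 1) +
      (σ.q k ≫ σ.j k ≫ L.map (r.χ k) - σ.t k ≫ L.map (r.χ (k + 1)) ≫ L.map (X.d (k + 1) k)) ≫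
        p.inl k := by
  obtain hk | rfl | hk := lt_trichotomy k n
  · have : σ.t k ≫ L.map (r.χ (k + 1)) ≫ L.map (X.d (k + 1) k) =
        σ.q k ≫ σ.j k ≫ L.map (r.χ k) := by
      rw [← L.map_comp, r.χ_d k hk, L.map_comp, σ.t_d_assoc]
    rw [this, coneκ, if_neg hk.ne, r.coneχ_of_le σ p hk]
    simp
  · rw [coneχ_top, coneκ, if_pos rfl, r.χ_zero (k + 1) (by lia)]
    simp
  · rw [coneχ, if_neg hk.ne', r.χ_zero (k + 1) (by lia), r.χ_zero k hk]
    simp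

/-- The retraction of the cone of `L X ⟶ X` onto the truncation of `M` to degrees `≤ n + 1` that
extends a retraction of `X` onto the truncation to degrees `≤ n`. -/
def cone : TruncRetract M P (n + 1) where
  π := r.coneπ σ p
  χ := r.coneχ σ p
  h := r.coneH σ p
  π_zero k hk := by
    obtain ⟨k, rfl⟩ : ∃ m, k = m + 1 := ⟨k - 1, by lia⟩
    simp [coneπ, r.π_zero k (by lia), r.π_zero (k + 1) (by lia)]
  χ_zero k hk := by
    obtain ⟨k, rfl⟩ : ∃ m, k = m + 1 := ⟨k - 1, by lia⟩
    rw [coneχ, if_neg (by lia), r.χ_zero (k + 1) (by lia), zero_comp]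
  π_d := r.coneπ_d σ p
  χ_d k hk := r.coneχ_d σ p hk
  χ_π k hk := r.coneχ_coneπ σ p hk
  h_d_zero := by
    refine p.hom_ext_zero ?_
    rw [inr_coneH_assoc, p.inr.comm, ← Category.assoc, r.h_d_zero, Preadditive.comp_sub,
      inr_coneπ_assoc, r.coneχ_of_le σ p (Nat.zero_le _), Preadditive.sub_comp]
    simp
  h_d_succ k := by
    refine p.hom_ext_succ ?_ ?_
    · rw [Preadditive.comp_add, inr_coneH_assoc, p.inr.comm, p.inr.comm_assoc, inr_coneH,
        ← Category.assoc, ← Category.assoc, ← Preadditive.add_comp, r.h_d_succ,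
        Preadditive.comp_sub, inr_coneπ_assoc]
      have : r.π (k + 1) ≫ r.coneχ σ p (k + 1) = (r.π (k + 1) ≫ r.χ (k + 1)) ≫ p.inr.f (k + 1) := by
        by_cases hk : k + 1 ≤ n
        · rw [r.coneχ_of_le σ p hk, Category.assoc]
        · simp [r.π_zero (k + 1) (by lia)]
      rw [this, Preadditive.sub_comp]
      simp
    · have hη : (L.map (r.h k) + L.map (r.π k) ≫ σ.t k ≫ L.map (r.χ (k + 1))) ≫
          η.app (X.X (k + 1)) = η.app (X.X k) ≫ r.h k +
            L.map (r.π k) ≫ σ.t k ≫ η.app (M.X (k + 1)) ≫ r.χ (k + 1) := by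
        simp [Preadditive.add_comp]
      have hd : L.map (r.h k) ≫ L.map (X.d (k + 1) k) = L.map (r.h k ≫ X.d (k + 1) k) :=
        (L.map_comp _ _).symm
      rw [Preadditive.comp_add, inl_coneH_assoc, Preadditive.comp_sub, Category.comp_id,
        inl_coneπ_assoc, coneκ_coneχ, Preadditive.neg_comp, Category.assoc, p.inl_d_succ,
        Preadditive.comp_sub, reassoc_of% hη]
      cases k with
      | zero =>
        rw [p.inl_d_zero_assoc, inr_coneH, σ.q_j_zero_assoc]
        simp only [Preadditive.add_comp, Preadditive.sub_comp, Preadditive.comp_add,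
          Preadditive.comp_sub, Category.assoc, reassoc_of% hd, r.h_d_zero, L.map_sub,
          L.map_comp, L.map_id, Category.id_comp]
        abel
      | succ k =>
        rw [p.inl_d_succ_assoc, Preadditive.sub_comp, Category.assoc, inr_coneH, Category.assoc,
          inl_coneH]
        have hs : L.map (r.h (k + 1)) ≫ L.map (X.d (k + 2) (k + 1)) =
            𝟙 _ - L.map (r.π (k + 1)) ≫ L.map (r.χ (k + 1)) -
              L.map (X.d (k + 1) k) ≫ L.map (r.h k) := by
          rw [← L.map_comp, eq_sub_of_add_eq (r.h_d_succ k)]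
          simp
        have hdt : L.map (X.d (k + 1) k) ≫ L.map (r.π k) ≫ σ.t k =
            L.map (r.π (k + 1)) ≫ (𝟙 _ - σ.q (k + 1) ≫ σ.j (k + 1)) := by
          rw [← σ.d_t, ← L.map_comp_assoc, ← r.π_d, L.map_comp_assoc]
        simp only [Preadditive.add_comp, Preadditive.sub_comp, Preadditive.comp_add,
          Preadditive.comp_sub, Preadditive.comp_neg, Category.assoc, reassoc_of% hs,
          reassoc_of% hdt, Category.id_comp]
        abel

end TruncRetract

end Retract

/-! ### Identities satisfied by the idempotents `e_n` -/

section Idempotents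

variable {A : Type u} [Category.{v} A] [Preadditive A] [MonoidalCategory A]
  {C : A} {ε : C ⟶ 𝟙_ A} {Δ : C ⟶ C ⊗ C}

variable (Δ) in
/-- The morphism `Δ ⋆ id : C ⋆ Y ⟶ C ⋆ (C ⋆ Y)`. -/
def comultLeft (Y : A) : C ⊗ Y ⟶ C ⊗ (C ⊗ Y) := (Δ ▷ Y) ≫ (α_ C C Y).hom

omit [Preadditive A] in
lemma whiskerLeft_comultLeft {Y Z : A} (g : Y ⟶ Z) :
    (C ◁ g) ≫ comultLeft Δ Z = comultLeft Δ Y ≫ (C ◁ C ◁ g) := by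
  simp [comultLeft, whisker_exchange_assoc]

omit [Preadditive A] in
lemma comultLeft_counitLeft (h : RightCounitAxiom ε Δ) (Y : A) :
    comultLeft Δ Y ≫ (C ◁ counitLeft ε Y) = 𝟙 _ := by
  have h' : Δ ≫ (C ◁ ε) ≫ (ρ_ C).hom = 𝟙 C := h
  rw [comultLeft, Category.assoc, assoc_whiskerLeft_counitLeft, ← comp_whiskerRight, h',
    id_whiskerRight]

variable [MonoidalPreadditive A]

/-- The recursion for `e_n` in terms of the differential of `Â_C`. -/
lemma e_succ_eq (n : ℕ) : e ε Δ (n + 2) = (C ◁ e ε Δ (n + 1)) -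
    (C ◁ delta ε Δ n : C ⊗ pow C (n + 1) ⟶ C ⊗ pow C n) ≫ comultLeft Δ (pow C n) := by
  have h4 : (α_ C C (pow C n)).inv ≫ (eTwo ε Δ ▷ pow C n) ≫ (α_ C C (pow C n)).hom =
      𝟙 _ - (C ◁ counitLeft ε (pow C n)) ≫ comultLeft Δ (pow C n) := by
    rw [eTwo, ← Category.assoc (C ◁ ε), sub_whiskerRight',
      comp_whiskerRight, ← assoc_whiskerLeft_counitLeft]
    simp [Preadditive.sub_comp, Preadditive.comp_sub, comultLeft]
  rw [e_succ_succ, h4, Preadditive.comp_sub, delta, counitAt_zero]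
  simp

lemma e_comp_whiskerLeft_e (h : RightCounitAxiom ε Δ) (n : ℕ) :
    e ε Δ (n + 1) ≫ (C ◁ e ε Δ n) = e ε Δ (n + 1) := by
  cases n with
  | zero => exact (congrArg _ (whiskerLeft_id _ _)).trans (Category.comp_id _)
  | succ n =>
    refine absorb_aux n _ fun j => ?_
    rw [← counitAt_succ]
    exact e_comp_counitAt h _ _

lemma whiskerLeft_e_comp_e (h : RightCounitAxiom ε Δ) (n : ℕ) :
    (C ◁ e ε Δ n) ≫ e ε Δ (n + 1) = e ε Δ (n + 1) := by
  cases n with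
  | zero => exact (congrArg (· ≫ _) (whiskerLeft_id _ _)).trans (Category.id_comp _)
  | succ n =>
    rw [e_succ_succ, ← whiskerLeft_comp_assoc, e_idem h]

lemma e_comp_whiskerLeft_delta (h : RightCounitAxiom ε Δ) (n : ℕ) :
    e ε Δ (n + 2) ≫ (C ◁ delta ε Δ n) = 0 := by
  rw [delta, MonoidalCategory.whiskerLeft_comp]
  erw [reassoc_of% (e_comp_whiskerLeft_e h (n + 1))]
  rw [← counitAt_succ]
  exact e_comp_counitAt h n 0

lemma whiskerLeft_delta_comp_e (h : RightCounitAxiom ε Δ) (n : ℕ) :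
    (C ◁ delta ε Δ n) ≫ e ε Δ (n + 1) = C ◁ delta ε Δ n := by
  cases n with
  | zero => exact (congrArg _ (show e ε Δ 1 = 𝟙 _ from rfl)).trans (Category.comp_id _)
  | succ n =>
    rw [e_succ_eq, Preadditive.comp_sub]
    erw [← whiskerLeft_comp, ← whiskerLeft_comp_assoc]
    rw [delta_comp_e h, delta_comp_delta h]
    simp

variable (ε Δ) in
/-- The composition of `e_{n+1}` with `Δ ⋆ id`. Between the images of `id ⋆ e_n` and `id ⋆ e_{n+1}`,
these morphisms are a contracting homotopy of `C ⋆ Â_C`. -/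
def contr (n : ℕ) : C ⊗ pow C n ⟶ C ⊗ pow C (n + 1) := e ε Δ (n + 1) ≫ comultLeft Δ (pow C n)

lemma contr_comp_whiskerLeft_e (h : RightCounitAxiom ε Δ) (n : ℕ) :
    contr ε Δ n ≫ (C ◁ e ε Δ (n + 1)) = contr ε Δ n := by
  refine absorb_aux n _ fun j => ?_
  cases n with
  | zero => exact j.elim0
  | succ n =>
  rw [contr, Category.assoc, counitAt_succ]
  erw [← whiskerLeft_comultLeft]
  rw [← counitAt_succ]
  erw [reassoc_of% (e_comp_counitAt h _ j)]
  simp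

lemma contr_comp_whiskerLeft_delta (h : RightCounitAxiom ε Δ) (n : ℕ) :
    contr ε Δ n ≫ (C ◁ delta ε Δ n) = e ε Δ (n + 1) := by
  rw [delta, MonoidalCategory.whiskerLeft_comp, reassoc_of% (contr_comp_whiskerLeft_e h n), contr,
    counitAt_zero, Category.assoc]
  erw [comultLeft_counitLeft h, Category.comp_id]

lemma whiskerLeft_delta_comp_contr (h : RightCounitAxiom ε Δ) (n : ℕ) :
    (C ◁ delta ε Δ n) ≫ contr ε Δ n = C ◁ e ε Δ (n + 1) - e ε Δ (n + 2) := by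
  rw [contr]
  erw [reassoc_of% (whiskerLeft_delta_comp_e h n)]
  rw [e_succ_eq, sub_sub_cancel]

omit [MonoidalPreadditive A] in
lemma e_comp_counitLeft (n : ℕ) :
    e ε Δ (n + 1) ≫ counitLeft ε (pow C n) = delta ε Δ n := by
  rw [delta, counitAt_zero]

end Idempotents

/-! ### The splitting of `C ⋆ Â_C` over the Karoubi envelope -/

section KaroubiTensor

variable {A : Type u} [Category.{v} A] [Preadditive A] [MonoidalCategory A]
  [MonoidalPreadditive A] {C : A}

variable (C) in
/-- The extension of `C ⋆ -` to the Karoubi envelope. -/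
@[simps]
def karTensorLeft : Karoubi A ⥤ Karoubi A where
  obj P := ⟨C ⊗ P.X, C ◁ P.p, by rw [← whiskerLeft_comp, P.idem]⟩
  map f := ⟨C ◁ f.f, by simp [← whiskerLeft_comp]⟩

instance : (karTensorLeft C).Additive where
  map_add {_ _ f g} := Karoubi.hom_ext _ _ (MonoidalPreadditive.whiskerLeft_add f.f g.f)

/-- The extension of `ε ⋆ id : C ⋆ Y ⟶ Y` to the Karoubi envelope. -/
@[simps]
def karCounit (ε : C ⟶ 𝟙_ A) : karTensorLeft C ⟶ 𝟭 (Karoubi A) where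
  app P := ⟨(C ◁ P.p) ≫ counitLeft ε P.X, by
    change (C ◁ P.p) ≫ ((C ◁ P.p) ≫ counitLeft ε P.X) ≫ P.p = (C ◁ P.p) ≫ counitLeft ε P.X
    rw [Category.assoc, ← whiskerLeft_counitLeft, ← whiskerLeft_comp_assoc,
      ← whiskerLeft_comp_assoc, P.idem, P.idem]⟩
  naturality P Q f := Karoubi.hom_ext _ _ (by
    change (C ◁ f.f) ≫ (C ◁ Q.p) ≫ counitLeft ε Q.X = ((C ◁ P.p) ≫ counitLeft ε P.X) ≫ f.f
    rw [Category.assoc, ← whiskerLeft_counitLeft, ← whiskerLeft_comp_assoc,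
      ← whiskerLeft_comp_assoc, Karoubi.comp_p, Karoubi.p_comp])

omit [Preadditive A] [MonoidalPreadditive A] in
lemma karCounit_toKaroubi_f (ε : C ⟶ 𝟙_ A) (Y : A) :
    ((karCounit ε).app ((toKaroubi A).obj Y)).f = counitLeft ε Y := by
  change (C ◁ 𝟙 Y) ≫ counitLeft ε Y = _
  rw [whiskerLeft_id, Category.id_comp]

omit [MonoidalCategory A] [MonoidalPreadditive A] in
lemma karoubi_sub_f {P Q : Karoubi A} (f g : P ⟶ Q) : (f - g).f = f.f - g.f :=
  (Karoubi.inclusionHom P Q).map_sub f g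

variable {ε : C ⟶ 𝟙_ A} {Δ : C ⟶ C ⊗ C} (h : RightCounitAxiom ε Δ)

lemma normalizedComplex_d (k : ℕ) : (normalizedComplex h).d (k + 1) k = deltaIm h k :=
  ChainComplex.of_d _ _ _

lemma normalizedComplex_d_f (k : ℕ) : ((normalizedComplex h).d (k + 1) k).f = delta ε Δ k := by
  rw [normalizedComplex_d]
  rfl

include h in
lemma contr_absorb (k : ℕ) :
    (C ◁ e ε Δ k) ≫ contr ε Δ k ≫ (C ◁ e ε Δ (k + 1)) = contr ε Δ k := by
  rw [contr_comp_whiskerLeft_e h, contr]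
  exact (Category.assoc _ _ _).symm.trans (congrArg (· ≫ _) (whiskerLeft_e_comp_e h k))

/-- The splitting of `C ⋆ Â_C`: both the inclusion of `im e_{k+1}` in `C ⋆ im e_k` and the
projection are given by `e_{k+1}`. -/
def normalizedSplitting :
    Splitting (karTensorLeft C) (karCounit ε) (normalizedComplex h) where
  j k := ⟨(e ε Δ (k + 1) : pow C (k + 1) ⟶ C ⊗ pow C k), by
    change e ε Δ (k + 1) ≫ e ε Δ (k + 1) ≫ (C ◁ e ε Δ k) = e ε Δ (k + 1)
    rw [e_comp_whiskerLeft_e h, e_idem h]⟩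
  q k := ⟨(e ε Δ (k + 1) : C ⊗ pow C k ⟶ pow C (k + 1)), by
    change (C ◁ e ε Δ k) ≫ e ε Δ (k + 1) ≫ e ε Δ (k + 1) = e ε Δ (k + 1)
    rw [e_idem h, whiskerLeft_e_comp_e h]⟩
  t k := ⟨contr ε Δ k, contr_absorb h k⟩
  j_q k := Karoubi.hom_ext _ _ (e_idem h (k + 1))
  j_η k := Karoubi.hom_ext _ _ (by
    rw [normalizedComplex_d_f]
    change e ε Δ (k + 1) ≫ (C ◁ e ε Δ k) ≫ counitLeft ε (pow C k) = delta ε Δ k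
    rw [← Category.assoc, e_comp_whiskerLeft_e h, e_comp_counitLeft])
  j_d k := Karoubi.hom_ext _ _ (by
    rw [normalizedComplex_d]
    exact e_comp_whiskerLeft_delta h k)
  q_j_zero := Karoubi.hom_ext _ _ ((e_idem h 1).trans (whiskerLeft_id C (𝟙_ A)).symm)
  t_d k := Karoubi.hom_ext _ _ (by
    rw [normalizedComplex_d]
    exact (contr_comp_whiskerLeft_delta h k).trans (e_idem h (k + 1)).symm)
  d_t k := Karoubi.hom_ext _ _ (by
    rw [normalizedComplex_d, karoubi_sub_f]
    refine (whiskerLeft_delta_comp_contr h k).trans ?_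
    exact congrArg (C ◁ e ε Δ (k + 1) - ·) (e_idem h (k + 2)).symm)

end KaroubiTensor

section Cone

variable {A : Type u} [Category.{v} A] [Preadditive A] [HasFiniteBiproducts A]
  [MonoidalCategory A] [MonoidalPreadditive A] {C : A} {ε : C ⟶ 𝟙_ A} {Δ : C ⟶ C ⊗ C}

variable (ε) in
/-- The presentation of `F ⋆ X` as a cone, over the Karoubi envelope. -/
def karConeDataTensor (X : ChainComplex A ℕ) :
    ConeData (K := fun k => (karTensorLeft C).obj ((toKar X).X k))
      (fun k => (karTensorLeft C).map ((toKar X).d (k + 1) k))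
      (X := toKar X) (fun k => (karCounit ε).app ((toKar X).X k)) (toKar (cone ε ⊗ X)) where
  inr := ((toKaroubi A).mapHomologicalComplex _).map (coneDataTensor ε X).inr
  inl k := ⟨(coneDataTensor ε X).inl k, by
    change (C ◁ 𝟙 (X.X k)) ≫ (coneDataTensor ε X).inl k ≫ 𝟙 ((cone ε ⊗ X).X (k + 1)) = _
    rw [whiskerLeft_id, Category.id_comp, Category.comp_id]⟩
  fst k := ⟨(coneDataTensor ε X).fst k, by
    change 𝟙 ((cone ε ⊗ X).X (k + 1)) ≫ (coneDataTensor ε X).fst k ≫ (C ◁ 𝟙 (X.X k)) = _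
    rw [whiskerLeft_id, Category.id_comp, Category.comp_id]⟩
  snd k := (toKaroubi A).map ((coneDataTensor ε X).snd k)
  inl_fst k := Karoubi.hom_ext _ _
    (((coneDataTensor ε X).inl_fst k).trans (whiskerLeft_id C (X.X k)).symm)
  inl_snd k := Karoubi.hom_ext _ _ ((coneDataTensor ε X).inl_snd k)
  inr_fst k := Karoubi.hom_ext _ _ ((coneDataTensor ε X).inr_fst k)
  inr_snd k := Karoubi.hom_ext _ _ ((coneDataTensor ε X).inr_snd k)
  total_zero := Karoubi.hom_ext _ _ (coneDataTensor ε X).total_zero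
  total_succ k := Karoubi.hom_ext _ _ ((coneDataTensor ε X).total_succ k)
  inl_d_zero := Karoubi.hom_ext _ _ ((coneDataTensor ε X).inl_d_zero.trans
    (congrArg (· ≫ (coneDataTensor ε X).inr.f 0) (karCounit_toKaroubi_f ε (X.X 0)).symm))
  inl_d_succ k := Karoubi.hom_ext _ _ (by
    rw [karoubi_sub_f]
    exact ((coneDataTensor ε X).inl_d_succ k).trans
      (congrArg (· ≫ (coneDataTensor ε X).inr.f (k + 1) - (C ◁ X.d (k + 1) k) ≫ _)
        (karCounit_toKaroubi_f ε (X.X (k + 1))).symm))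

open HomologicalComplex

variable (ε) in
lemma isZero_toKar_unit (k : ℕ) : IsZero ((toKar (conePow ε 0)).X (k + 1)) :=
  (toKaroubi A).map_isZero (isZero_single_obj_X _ _ _ _ (by simp))

/-- The unit complex is the truncation of `Â_C` to degree zero. -/
def truncRetractUnit (h : RightCounitAxiom ε Δ) :
    TruncRetract (normalizedComplex h) (toKar (conePow ε 0)) 0 where
  π
    | 0 => (toKaroubi A).map (singleObjXSelf (ComplexShape.down ℕ) 0 (𝟙_ A)).hom
    | _ + 1 => 0
  χ
    | 0 => (toKaroubi A).map (singleObjXSelf (ComplexShape.down ℕ) 0 (𝟙_ A)).inv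
    | _ + 1 => 0
  h _ := 0
  π_zero k hk := by
    obtain ⟨k, rfl⟩ : ∃ m, k = m + 1 := ⟨k - 1, by lia⟩
    rfl
  χ_zero k hk := by
    obtain ⟨k, rfl⟩ : ∃ m, k = m + 1 := ⟨k - 1, by lia⟩
    rfl
  π_d k := (isZero_toKar_unit ε k).eq_of_src _ _
  χ_d k hk := by lia
  χ_π k hk := by
    obtain rfl : k = 0 := by lia
    exact ((toKaroubi A).map_comp _ _).symm.trans
      ((congrArg (toKaroubi A).map (Iso.inv_hom_id _)).trans ((toKaroubi A).map_id _))
  h_d_zero := by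
    rw [zero_comp, eq_comm, sub_eq_zero, eq_comm]
    exact ((toKaroubi A).map_comp _ _).symm.trans
      ((congrArg (toKaroubi A).map (Iso.hom_inv_id _)).trans ((toKaroubi A).map_id _))
  h_d_succ k := (isZero_toKar_unit ε k).eq_of_src _ _

/-- The retraction of `F^{⋆ n}` onto the truncation of `Â_C` to degrees `≤ n`. -/
def truncRetractConePow (h : RightCounitAxiom ε Δ) :
    ∀ n, TruncRetract (normalizedComplex h) (toKar (conePow ε n)) n
  | 0 => truncRetractUnit h
  | n + 1 => (truncRetractConePow h n).cone (normalizedSplitting h)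
      (karConeDataTensor ε (conePow ε n))

end Cone

/-! ### Homotopy equivalences obtained from truncated retractions -/

section RetractEquiv

variable {D : Type u} [Category.{v} D] [Preadditive D] {M X T : ChainComplex D ℕ} {n : ℕ}

/-- If `T` is the truncation of `M` to degrees `≤ n`, a truncated retraction is a homotopy
equivalence with `T`. -/
def TruncRetract.homotopyEquiv (r : TruncRetract M X n) (i : ∀ k, T.X k ⟶ M.X k)
    (p : ∀ k, M.X k ⟶ T.X k) (hip : ∀ k, i k ≫ p k = 𝟙 _) (hpi : ∀ k, k ≤ n → p k ≫ i k = 𝟙 _)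
    (hd : ∀ k, k + 1 ≤ n → T.d (k + 1) k = i (k + 1) ≫ M.d (k + 1) k ≫ p k)
    (hT : ∀ k, n < k → IsZero (T.X k)) : HomotopyEquiv X T where
  hom := homOfSucc (fun k => r.π k ≫ p k) fun k => by
    obtain hk | hk := Nat.lt_or_ge n (k + 1)
    · rw [← r.π_d_assoc, r.π_zero _ hk, (hT _ hk).eq_of_src (T.d (k + 1) k) 0, comp_zero,
        zero_comp]
    · rw [hd k hk, Category.assoc, reassoc_of% (hpi _ hk), r.π_d_assoc]
  inv := homOfSucc (fun k => i k ≫ r.χ k) fun k => by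
    obtain hk | hk := Nat.lt_or_ge n (k + 1)
    · exact (hT _ hk).eq_of_src _ _
    · rw [hd k hk, Category.assoc, Category.assoc, Category.assoc, reassoc_of% (hpi k (by lia)),
        r.χ_d k hk]
  homotopyHomInvId := by
    have key : ∀ k, (r.π k ≫ p k) ≫ i k ≫ r.χ k = r.π k ≫ r.χ k := fun k => by
      obtain hk | hk := Nat.lt_or_ge n k
      · simp [r.π_zero k hk]
      · rw [Category.assoc, reassoc_of% (hpi k hk)]
    refine Homotopy.symm (homotopyOfSucc r.h ?_ fun k => ?_)
    · exact r.h_d_zero.trans (congrArg (𝟙 _ - ·) (key 0).symm)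
    · exact (r.h_d_succ k).trans (congrArg (𝟙 _ - ·) (key (k + 1)).symm)
  homotopyInvHomId := Homotopy.ofEq (by
    ext k
    obtain hk | hk := Nat.lt_or_ge n k
    · exact (hT k hk).eq_of_src _ _
    · change (i k ≫ r.χ k) ≫ r.π k ≫ p k = 𝟙 _
      rw [Category.assoc, r.χ_π_assoc k hk, hip])

end RetractEquiv

section Truncated

variable {A : Type u} [Category.{v} A] [Preadditive A] [HasFiniteBiproducts A]
  [MonoidalCategory A] [MonoidalPreadditive A] {C : A} {ε : C ⟶ 𝟙_ A} {Δ : C ⟶ C ⊗ C}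

omit [HasFiniteBiproducts A] in
lemma truncatedComplex_d (h : RightCounitAxiom ε Δ) (n k : ℕ) :
    (truncatedComplex h n).d (k + 1) k = ⟨deltaTrunc ε Δ n k, deltaTrunc_comm h n k⟩ :=
  ChainComplex.of_d (imETrunc h n) (fun k => Karoubi.Hom.mk _ (deltaTrunc_comm h n k)) k

lemma hEquiv_conePow_truncatedComplex (h : RightCounitAxiom ε Δ) (n : ℕ) :
    HEquiv (toKar (conePow ε n)) (truncatedComplex h n) := by
  refine ⟨(truncRetractConePow h n).homotopyEquiv
    (fun k => ⟨if k ≤ n then e ε Δ k else 0, ?_⟩) (fun k => ⟨if k ≤ n then e ε Δ k else 0, ?_⟩)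
    (fun k => Karoubi.hom_ext _ _ ?_) (fun k hk => Karoubi.hom_ext _ _ ?_)
    (fun k hk => ?_) (fun k hk => ?_)⟩
  · change (if k ≤ n then e ε Δ k else 0) ≫ (if k ≤ n then e ε Δ k else 0) ≫ e ε Δ k =
      (if k ≤ n then e ε Δ k else 0)
    split_ifs <;> simp [e_idem h]
  · change e ε Δ k ≫ (if k ≤ n then e ε Δ k else 0) ≫ (if k ≤ n then e ε Δ k else 0) =
      (if k ≤ n then e ε Δ k else 0)
    split_ifs <;> simp [e_idem h]
  · change (if k ≤ n then e ε Δ k else 0) ≫ (if k ≤ n then e ε Δ k else 0) =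
      (if k ≤ n then e ε Δ k else 0)
    split_ifs <;> simp [e_idem h]
  · change (if k ≤ n then e ε Δ k else 0) ≫ (if k ≤ n then e ε Δ k else 0) = e ε Δ k
    rw [if_pos hk, e_idem h]
  · rw [truncatedComplex_d, normalizedComplex_d]
    refine Karoubi.hom_ext _ _ ?_
    change deltaTrunc ε Δ n k = (if k + 1 ≤ n then e ε Δ (k + 1) else 0) ≫ delta ε Δ k ≫
      (if k ≤ n then e ε Δ k else 0)
    rw [deltaTrunc, if_pos hk, if_pos hk, if_pos (by lia), delta_comp_e h, e_comp_delta h]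
  · -- An object of the Karoubi envelope is zero if its idempotent is.
    refine (IsZero.iff_id_eq_zero _).2 (Karoubi.hom_ext _ _ ?_)
    exact if_neg (by lia)

end Truncated

/-! ### Telescopes of compatible truncated retractions -/

section Telescopes

variable {D : Type u} [Category.{v} D] [Preadditive D]

/-- A presentation of `P` as the mapping telescope of `X 0 ⟶ X 1 ⟶ ⋯`: each term of `P` is a
coproduct of the terms of all `X n` and, in positive degrees, of all the shifted `X n`; the maps
`a n` are morphisms of complexes, and `b n` is a homotopy from `a n` to `φ n ≫ a (n + 1)`. -/
structure TelescopeData {X : ℕ → ChainComplex D ℕ} (φ : ∀ n, X n ⟶ X (n + 1))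
    (P : ChainComplex D ℕ) where
  /-- the inclusion of `X n` -/
  a : ∀ n, X n ⟶ P
  /-- the inclusion of the shift of `X n` -/
  b : ∀ n k, (X n).X k ⟶ P.X (k + 1)
  b_d_zero : ∀ n, b n 0 ≫ P.d 1 0 = (a n).f 0 - (φ n).f 0 ≫ (a (n + 1)).f 0
  b_d_succ : ∀ n k, b n (k + 1) ≫ P.d (k + 2) (k + 1) =
    (a n).f (k + 1) - (φ n).f (k + 1) ≫ (a (n + 1)).f (k + 1) - (X n).d (k + 1) k ≫ b n k
  hom_ext_zero : ∀ {Z : D} {u w : P.X 0 ⟶ Z}, (∀ n, (a n).f 0 ≫ u = (a n).f 0 ≫ w) → u = w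
  hom_ext_succ : ∀ {k : ℕ} {Z : D} {u w : P.X (k + 1) ⟶ Z},
    (∀ n, (a n).f (k + 1) ≫ u = (a n).f (k + 1) ≫ w) → (∀ n, b n k ≫ u = b n k ≫ w) → u = w
  exists_desc_zero : ∀ {Z : D} (f : ∀ n, (X n).X 0 ⟶ Z),
    ∃ u : P.X 0 ⟶ Z, ∀ n, (a n).f 0 ≫ u = f n
  exists_desc_succ : ∀ {k : ℕ} {Z : D} (f : ∀ n, (X n).X (k + 1) ⟶ Z)
    (g : ∀ n, (X n).X k ⟶ Z),
    ∃ u : P.X (k + 1) ⟶ Z, (∀ n, (a n).f (k + 1) ≫ u = f n) ∧ ∀ n, b n k ≫ u = g n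

/-- Retractions of the `X n` onto the truncations of `M` that are compatible with the transition
maps, on the nose. -/
structure CompatibleRetracts {X : ℕ → ChainComplex D ℕ} (φ : ∀ n, X n ⟶ X (n + 1))
    {M : ChainComplex D ℕ} (r : ∀ n, TruncRetract M (X n) n) : Prop where
  φ_π : ∀ n k, (φ n).f k ≫ (r (n + 1)).π k = (r n).π k
  χ_φ : ∀ n k, k ≤ n → (r n).χ k ≫ (φ n).f k = (r (n + 1)).χ k
  φ_h : ∀ n k, (φ n).f k ≫ (r (n + 1)).h k = (r n).h k ≫ (φ n).f (k + 1)

namespace TelescopeData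

variable {X : ℕ → ChainComplex D ℕ} {φ : ∀ n, X n ⟶ X (n + 1)} {P M : ChainComplex D ℕ}
  (T : TelescopeData φ P) {r : ∀ n, TruncRetract M (X n) n} (hr : CompatibleRetracts φ r)

include hr in
/-- The `n`-th map to `M` is the projection of `X n`; the shifted copies are sent to zero. -/
lemma exists_toLimit : ∃ p : P ⟶ M, (∀ n k, (T.a n).f k ≫ p.f k = (r n).π k) ∧
    ∀ n k, T.b n k ≫ p.f (k + 1) = 0 := by
  choose p₀ hp₀ using T.exists_desc_zero fun n => (r n).π 0
  choose p₁ hp₁ hp₂ using fun k => T.exists_desc_succ (fun n => (r n).π (k + 1))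
    (fun n => (0 : (X n).X k ⟶ M.X (k + 1)))
  let f : ∀ k, P.X k ⟶ M.X k
    | 0 => p₀
    | k + 1 => p₁ k
  have hf : ∀ n k, (T.a n).f k ≫ f k = (r n).π k
    | n, 0 => hp₀ n
    | n, k + 1 => hp₁ k n
  have hf' : ∀ n k, T.b n k ≫ f (k + 1) = 0 := fun n k => hp₂ k n
  refine ⟨homOfSucc f fun k => T.hom_ext_succ (fun n => ?_) (fun n => ?_), hf, hf'⟩
  · rw [reassoc_of% (hf n (k + 1)), (r n).π_d, (T.a n).comm_assoc, hf]
  · rw [reassoc_of% (hf' n k), zero_comp]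
    cases k with
    | zero =>
      rw [← Category.assoc, T.b_d_zero, Preadditive.sub_comp, Category.assoc, hf, hf, hr.φ_π,
        sub_self]
    | succ k =>
      rw [← Category.assoc, T.b_d_succ, Preadditive.sub_comp, Preadditive.sub_comp,
        Category.assoc, Category.assoc, hf, hf, hr.φ_π, hf', comp_zero, sub_self, sub_zero]

variable (r) in
/-- The components of the map from `M` to the telescope: `M k` is sent to the copy of `X k`, with
a correction in the shifted copy of `X (k - 1)` which compensates for the fact that the
differential of `M` lands in `M (k - 1)`, which is sent to the copy of `X (k - 1)`. -/
def fromLimitF : ∀ k, M.X k ⟶ P.X k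
  | 0 => (r 0).χ 0 ≫ (T.a 0).f 0
  | k + 1 => (r (k + 1)).χ (k + 1) ≫ (T.a (k + 1)).f (k + 1) +
      M.d (k + 1) k ≫ (r k).χ k ≫ T.b k k

include hr in
lemma fromLimitF_comm (k : ℕ) :
    T.fromLimitF r (k + 1) ≫ P.d (k + 1) k = M.d (k + 1) k ≫ T.fromLimitF r k := by
  rw [fromLimitF, Preadditive.add_comp, Category.assoc, Category.assoc, Category.assoc,
    (T.a (k + 1)).comm, ← Category.assoc, (r (k + 1)).χ_d k le_rfl, Category.assoc]
  cases k with
  | zero =>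
    rw [T.b_d_zero, Preadditive.comp_sub, ← hr.χ_φ 0 0 le_rfl, Category.assoc, fromLimitF,
      Preadditive.comp_sub]
    abel
  | succ k =>
    rw [T.b_d_succ, Preadditive.comp_sub, Preadditive.comp_sub, ← hr.χ_φ (k + 1) (k + 1) le_rfl,
      Category.assoc, fromLimitF, ← Category.assoc ((r (k + 1)).χ (k + 1)) ((X (k + 1)).d _ _),
      (r (k + 1)).χ_d k le_rfl, Category.assoc]
    simp only [Preadditive.comp_sub, Preadditive.comp_add, M.d_comp_d_assoc, zero_comp]
    abel

variable (r) in
/-- The sum of the shifted copies of `M k` in the first `n` pieces of the telescope. -/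
def shiftSum (n k : ℕ) : M.X k ⟶ P.X (k + 1) :=
  ∑ j ∈ Finset.range n, (r j).χ k ≫ T.b j k

lemma shiftSum_succ (n k : ℕ) :
    T.shiftSum r (n + 1) k = T.shiftSum r n k + (r n).χ k ≫ T.b n k :=
  Finset.sum_range_succ _ _

lemma shiftSum_of_le {n k : ℕ} (hn : n ≤ k) : T.shiftSum r n k = 0 :=
  Finset.sum_eq_zero fun j hj => by
    rw [(r j).χ_zero k (by have := Finset.mem_range.1 hj; lia), zero_comp]

include hr in
lemma shiftSum_d_zero (n : ℕ) :
    T.shiftSum r n 0 ≫ P.d 1 0 = T.fromLimitF r 0 - (r n).χ 0 ≫ (T.a n).f 0 := by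
  induction n with
  | zero => simp [T.shiftSum_of_le le_rfl, fromLimitF]
  | succ n ih =>
    rw [shiftSum_succ, Preadditive.add_comp, ih, Category.assoc, T.b_d_zero, Preadditive.comp_sub,
      ← hr.χ_φ n 0 (Nat.zero_le _), Category.assoc]
    abel

include hr in
/-- Telescoping: on `M (k + 1)`, the sum of the shifted copies is a homotopy from the `n`-th copy
to the image in the telescope. -/
lemma shiftSum_d_succ {n k : ℕ} (hn : k + 1 ≤ n) :
    T.shiftSum r n (k + 1) ≫ P.d (k + 2) (k + 1) + M.d (k + 1) k ≫ T.shiftSum r n k =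
      T.fromLimitF r (k + 1) - (r n).χ (k + 1) ≫ (T.a n).f (k + 1) := by
  induction n, hn using Nat.le_induction with
  | base =>
    rw [T.shiftSum_of_le le_rfl, shiftSum_succ, T.shiftSum_of_le le_rfl, fromLimitF]
    simp
  | succ n hn ih =>
    have hb : (r n).χ (k + 1) ≫ T.b n (k + 1) ≫ P.d (k + 2) (k + 1) +
        M.d (k + 1) k ≫ (r n).χ k ≫ T.b n k =
        (r n).χ (k + 1) ≫ (T.a n).f (k + 1) -
          (r (n + 1)).χ (k + 1) ≫ (T.a (n + 1)).f (k + 1) := by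
      rw [T.b_d_succ, Preadditive.comp_sub, Preadditive.comp_sub, ← hr.χ_φ n (k + 1) hn,
        Category.assoc, ← Category.assoc _ ((X n).d _ _), (r n).χ_d k hn, Category.assoc,
        sub_add_cancel]
    rw [shiftSum_succ, shiftSum_succ, Preadditive.add_comp, Preadditive.comp_add, add_add_add_comm,
      ih, Category.assoc, hb]
    abel

include hr T in
/-- The telescope of complexes that retract compatibly onto the truncations of `M` is homotopy
equivalent to `M`. -/
theorem hEquiv : HEquiv P M := by
  obtain ⟨p, hp, hp'⟩ := T.exists_toLimit hr
  let s : M ⟶ P := homOfSucc (T.fromLimitF r) (T.fromLimitF_comm hr)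
  choose H₀ hH₀ using T.exists_desc_zero fun n =>
    (r n).π 0 ≫ T.shiftSum r n 0 - (r n).h 0 ≫ (T.a n).f 1
  choose H₁ hH₁ hH₂ using fun k => T.exists_desc_succ
    (fun n => (r n).π (k + 1) ≫ T.shiftSum r n (k + 1) - (r n).h (k + 1) ≫ (T.a n).f (k + 2))
    (fun n => (r n).h k ≫ T.b n (k + 1))
  let H : ∀ k, P.X k ⟶ P.X (k + 1)
    | 0 => H₀
    | k + 1 => H₁ k
  have hH : ∀ n k, (T.a n).f k ≫ H k =
      (r n).π k ≫ T.shiftSum r n k - (r n).h k ≫ (T.a n).f (k + 1)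
    | n, 0 => hH₀ n
    | n, k + 1 => hH₁ k n
  have hH' : ∀ n k, T.b n k ≫ H (k + 1) = (r n).h k ≫ T.b n (k + 1) := fun n k => hH₂ k n
  refine ⟨{ hom := p, inv := s, homotopyHomInvId := homotopyOfSucc H ?_ fun k => ?_,
            homotopyInvHomId := Homotopy.ofEq ?_ }⟩
  · refine T.hom_ext_zero fun n => ?_
    change _ = (T.a n).f 0 ≫ (p.f 0 ≫ T.fromLimitF r 0 - 𝟙 _)
    rw [reassoc_of% (hH n 0), Preadditive.comp_sub, reassoc_of% (hp n 0), Preadditive.sub_comp,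
      Category.assoc, Category.assoc, (T.a n).comm, T.shiftSum_d_zero hr,
      ← Category.assoc ((r n).h 0), (r n).h_d_zero]
    simp [Preadditive.comp_sub, Preadditive.sub_comp]
  · refine T.hom_ext_succ (fun n => ?_) (fun n => ?_)
    · change _ = (T.a n).f (k + 1) ≫ (p.f (k + 1) ≫ T.fromLimitF r (k + 1) - 𝟙 _)
      have hS : (r n).π (k + 1) ≫ T.shiftSum r n (k + 1) ≫ P.d (k + 2) (k + 1) +
          (r n).π (k + 1) ≫ M.d (k + 1) k ≫ T.shiftSum r n k =
          (r n).π (k + 1) ≫ (T.fromLimitF r (k + 1) - (r n).χ (k + 1) ≫ (T.a n).f (k + 1)) := by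
        obtain hk | hk := Nat.lt_or_ge n (k + 1)
        · simp [(r n).π_zero _ hk]
        · rw [← Preadditive.comp_add, T.shiftSum_d_succ hr hk]
      have hh := congrArg (· ≫ (T.a n).f (k + 1)) ((r n).h_d_succ k)
      simp only [Preadditive.add_comp, Preadditive.sub_comp, Category.assoc,
        Category.id_comp] at hh
      rw [Preadditive.comp_add, reassoc_of% (hH n (k + 1)), (T.a n).comm_assoc, hH,
        Preadditive.comp_sub, Preadditive.sub_comp, Preadditive.comp_sub,
        reassoc_of% (hp n (k + 1)), Category.assoc, Category.assoc, (T.a n).comm, ← (r n).π_d_assoc,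
        Category.comp_id, sub_add_sub_comm, hS, hh, Preadditive.comp_sub]
      abel
    · change _ = T.b n k ≫ (p.f (k + 1) ≫ T.fromLimitF r (k + 1) - 𝟙 _)
      have ha : ((T.a n).f k - (φ n).f k ≫ (T.a (n + 1)).f k) ≫ H k =
          (r n).h k ≫ (φ n).f (k + 1) ≫ (T.a (n + 1)).f (k + 1) -
            (r n).π k ≫ (r n).χ k ≫ T.b n k - (r n).h k ≫ (T.a n).f (k + 1) := by
        rw [Preadditive.sub_comp, Category.assoc, hH, hH, Preadditive.comp_sub, ← Category.assoc,
          hr.φ_π, ← Category.assoc ((φ n).f k), hr.φ_h, shiftSum_succ, Preadditive.comp_add,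
          Category.assoc]
        abel
      rw [Preadditive.comp_add, reassoc_of% (hH' n k), T.b_d_succ,
        Preadditive.comp_sub _ (p.f _ ≫ _), reassoc_of% (hp' n k), zero_comp,
        Category.comp_id, zero_sub]
      cases k with
      | zero =>
        rw [← Category.assoc (T.b n 0), T.b_d_zero, ha, Preadditive.comp_sub, Preadditive.comp_sub,
          ← Category.assoc _ ((X n).d _ _), (r n).h_d_zero, Preadditive.sub_comp, Category.id_comp,
          Category.assoc]
        abel
      | succ k =>
        have hh : (r n).h (k + 1) ≫ (X n).d (k + 2) (k + 1) ≫ T.b n (k + 1) =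
            T.b n (k + 1) - (r n).π (k + 1) ≫ (r n).χ (k + 1) ≫ T.b n (k + 1) -
              (X n).d (k + 1) k ≫ (r n).h k ≫ T.b n (k + 1) := by
          rw [← Category.assoc, eq_sub_of_add_eq ((r n).h_d_succ k)]
          simp [Preadditive.sub_comp]
        rw [← Category.assoc (T.b n (k + 1)), T.b_d_succ, Preadditive.sub_comp, ha,
          Category.assoc, hH', Preadditive.comp_sub, Preadditive.comp_sub, hh]
        abel
  · ext k
    change T.fromLimitF r k ≫ p.f k = 𝟙 _
    cases k with
    | zero => rw [fromLimitF, Category.assoc, hp, (r 0).χ_π 0 le_rfl]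
    | succ k =>
      rw [fromLimitF, Preadditive.add_comp, Category.assoc, Category.assoc, Category.assoc, hp,
        hp', (r (k + 1)).χ_π _ le_rfl]
      simp

end TelescopeData

end Telescopes

/-! ### The telescope of the tensor powers of the cone -/

section TelescopePresentation

variable {D : Type u} [Category.{v} D] [Preadditive D]

/-- A telescope presentation can be transported along isomorphisms of directed systems. -/
def TelescopeData.ofIso {X X' : ℕ → ChainComplex D ℕ} {φ : ∀ n, X n ⟶ X (n + 1)}
    {φ' : ∀ n, X' n ⟶ X' (n + 1)} {P : ChainComplex D ℕ} (T : TelescopeData φ P)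
    (i : ∀ n, X' n ≅ X n) (hi : ∀ n, φ' n ≫ (i (n + 1)).hom = (i n).hom ≫ φ n) :
    TelescopeData φ' P where
  a n := (i n).hom ≫ T.a n
  b n k := (i n).hom.f k ≫ T.b n k
  b_d_zero n := by
    have := congrArg (fun f => HomologicalComplex.Hom.f f 0) (hi n)
    simp only [HomologicalComplex.comp_f] at this
    simp [T.b_d_zero, reassoc_of% this, Preadditive.comp_sub]
  b_d_succ n k := by
    have := congrArg (fun f => HomologicalComplex.Hom.f f (k + 1)) (hi n)
    simp only [HomologicalComplex.comp_f] at this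
    simp [T.b_d_succ, reassoc_of% this, Preadditive.comp_sub]
  hom_ext_zero h := T.hom_ext_zero fun n => by
    simpa using (i n).inv.f 0 ≫= h n
  hom_ext_succ {k _ _ _} h h' := T.hom_ext_succ
    (fun n => by simpa using (i n).inv.f (k + 1) ≫= h n)
    (fun n => by simpa using (i n).inv.f k ≫= h' n)
  exists_desc_zero f := by
    obtain ⟨u, hu⟩ := T.exists_desc_zero fun n => (i n).inv.f 0 ≫ f n
    exact ⟨u, fun n => by simp [hu]⟩
  exists_desc_succ {k _} f g := by
    obtain ⟨u, hu, hu'⟩ := T.exists_desc_succ (fun n => (i n).inv.f (k + 1) ≫ f n)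
      (fun n => (i n).inv.f k ≫ g n)
    exact ⟨u, fun n => by simp [hu], fun n => by simp [hu']⟩

/-- A telescope presentation remains one over the Karoubi envelope. -/
def TelescopeData.toKar {X : ℕ → ChainComplex D ℕ} {φ : ∀ n, X n ⟶ X (n + 1)}
    {P : ChainComplex D ℕ} (T : TelescopeData φ P) :
    TelescopeData (fun n => ((toKaroubi D).mapHomologicalComplex _).map (φ n))
      (CounitalPowers.toKar P) where
  a n := ((toKaroubi D).mapHomologicalComplex _).map (T.a n)
  b n k := (toKaroubi D).map (T.b n k)
  b_d_zero n := Karoubi.hom_ext _ _ (by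
    rw [karoubi_sub_f]
    exact T.b_d_zero n)
  b_d_succ n k := Karoubi.hom_ext _ _ (by
    rw [karoubi_sub_f, karoubi_sub_f]
    exact T.b_d_succ n k)
  hom_ext_zero h := Karoubi.hom_ext _ _
    (T.hom_ext_zero fun n => congrArg Karoubi.Hom.f (h n))
  hom_ext_succ h h' := Karoubi.hom_ext _ _
    (T.hom_ext_succ (fun n => congrArg Karoubi.Hom.f (h n))
      (fun n => congrArg Karoubi.Hom.f (h' n)))
  exists_desc_zero {Z} f := by
    obtain ⟨u, hu⟩ := T.exists_desc_zero fun n => (f n).f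
    refine ⟨⟨u ≫ Z.p, ?_⟩, fun n => Karoubi.hom_ext _ _ ?_⟩
    · exact (Category.id_comp _).trans ((Category.assoc _ _ _).trans (congrArg (u ≫ ·) Z.idem))
    · exact (Category.assoc _ _ _).symm.trans
        ((congrArg (· ≫ Z.p) (hu n)).trans (Karoubi.comp_p (f n)))
  exists_desc_succ {k Z} f g := by
    obtain ⟨u, hu, hu'⟩ := T.exists_desc_succ (fun n => (f n).f) (fun n => (g n).f)
    refine ⟨⟨u ≫ Z.p, ?_⟩, fun n => Karoubi.hom_ext _ _ ?_, fun n => Karoubi.hom_ext _ _ ?_⟩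
    · exact (Category.id_comp _).trans ((Category.assoc _ _ _).trans (congrArg (u ≫ ·) Z.idem))
    · exact (Category.assoc _ _ _).symm.trans
        ((congrArg (· ≫ Z.p) (hu n)).trans (Karoubi.comp_p (f n)))
    · exact (Category.assoc _ _ _).symm.trans
        ((congrArg (· ≫ Z.p) (hu' n)).trans (Karoubi.comp_p (g n)))

variable [HasCountableCoproducts D] (X : ℕ → ChainComplex D ℕ)

/-- Coproducts of complexes are computed degreewise. -/
def coproductXIsColimit (k : ℕ) :
    IsColimit ((HomologicalComplex.eval D (ComplexShape.down ℕ) k).mapCocone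
      (colimit.cocone (Discrete.functor X))) :=
  isColimitOfPreserves _ (colimit.isColimit _)

variable {X} in
lemma coproductX_hom_ext {k : ℕ} {Z : D} {u w : (∐ X).X k ⟶ Z}
    (h : ∀ n, (Sigma.ι X n).f k ≫ u = (Sigma.ι X n).f k ≫ w) : u = w :=
  (coproductXIsColimit X k).hom_ext fun n => h n.as

lemma coproductX_exists_desc {k : ℕ} {Z : D} (f : ∀ n, (X n).X k ⟶ Z) :
    ∃ u : (∐ X).X k ⟶ Z, ∀ n, (Sigma.ι X n).f k ≫ u = f n :=
  ⟨(coproductXIsColimit X k).desc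
      ⟨Z, Discrete.natTrans fun n => f n.as⟩,
    fun n => (coproductXIsColimit X k).fac ⟨Z, Discrete.natTrans fun n => f n.as⟩ ⟨n⟩⟩

variable [HasFiniteBiproducts D] {X} (φ : ∀ n, X n ⟶ X (n + 1))

/-- The presentation of the mapping telescope. -/
def telescopeData : TelescopeData φ (telescope X φ) :=
  let g : ∐ X ⟶ ∐ X := 𝟙 (∐ X) - Sigma.desc fun n => φ n ≫ Sigma.ι X (n + 1)
  let p : ConeData (fun k => (∐ X).d (k + 1) k) g.f (telescope X φ) := coneDataHomotopyCofiber g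
  have hg : ∀ n k, (Sigma.ι X n).f k ≫ g.f k =
      (Sigma.ι X n).f k - (φ n).f k ≫ (Sigma.ι X (n + 1)).f k := fun n k => by
    have : Sigma.ι X n ≫ g = Sigma.ι X n - φ n ≫ Sigma.ι X (n + 1) := by
      simp [g, Preadditive.comp_sub]
    simpa using congrArg (fun f => HomologicalComplex.Hom.f f k) this
  { a n := Sigma.ι X n ≫ p.inr
    b n k := (Sigma.ι X n).f k ≫ p.inl k
    b_d_zero n := by
      simp [p.inl_d_zero, reassoc_of% (hg n 0), Preadditive.sub_comp]
    b_d_succ n k := by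
      simp [p.inl_d_succ, reassoc_of% (hg n (k + 1)), Preadditive.sub_comp, Preadditive.comp_sub]
    hom_ext_zero h := p.hom_ext_zero (coproductX_hom_ext fun n => by simpa using h n)
    hom_ext_succ h h' := p.hom_ext_succ (coproductX_hom_ext fun n => by simpa using h n)
      (coproductX_hom_ext fun n => by simpa using h' n)
    exists_desc_zero f := by
      obtain ⟨u, hu⟩ := coproductX_exists_desc X f
      exact ⟨p.snd 0 ≫ u, fun n => by simp [hu]⟩
    exists_desc_succ {k _} f g := by
      obtain ⟨u, hu⟩ := coproductX_exists_desc X f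
      obtain ⟨w, hw⟩ := coproductX_exists_desc X g
      exact ⟨p.snd (k + 1) ≫ u + p.fst k ≫ w, fun n => by simp [hu, Preadditive.comp_add],
        fun n => by simp [hw, Preadditive.comp_add]⟩ }

end TelescopePresentation

section KaroubiImage

variable {A : Type u} [Category.{v} A] [Preadditive A] {B : Type u'} [Category.{v'} B]
  [Preadditive B] (G : A ⥤ B) [G.Additive]

variable (A B) in
/-- The extension of `G` to Karoubi envelopes restricts to `G`. -/
def toKaroubiCompExtensionIso (G : A ⥤ B) :
    toKaroubi A ⋙ (functorExtension₂ A B).obj G ≅ G ⋙ toKaroubi B :=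
  (functorExtension₂CompWhiskeringLeftToKaroubiIso A B).app G

/-- On complexes, the extension of `G` to Karoubi envelopes restricts to `G`. -/
def karMapToKarIso :
    (toKaroubi A).mapHomologicalComplex (ComplexShape.down ℕ) ⋙
      ((functorExtension₂ A B).obj G).mapHomologicalComplex _ ≅
    G.mapHomologicalComplex _ ⋙ (toKaroubi B).mapHomologicalComplex _ :=
  NatIso.mapHomologicalComplex (toKaroubiCompExtensionIso A B G) _

end KaroubiImage

section ConePowers

variable {A : Type u} [Category.{v} A] [Preadditive A] [HasFiniteBiproducts A]
  [MonoidalCategory A] [MonoidalPreadditive A] {C : A} {ε : C ⟶ 𝟙_ A} {Δ : C ⟶ C ⊗ C}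

lemma compatibleRetracts_conePow (h : RightCounitAxiom ε Δ) :
    CompatibleRetracts
      (fun n => ((toKaroubi A).mapHomologicalComplex _).map (conePowMap ε n))
      (truncRetractConePow h) where
  φ_π n := TruncRetract.inr_coneπ _ _ (karConeDataTensor ε (conePow ε n))
  χ_φ n _ hk := (TruncRetract.coneχ_of_le (truncRetractConePow h n) (normalizedSplitting h)
    (karConeDataTensor ε (conePow ε n)) hk).symm
  φ_h n := TruncRetract.inr_coneH _ _ (karConeDataTensor ε (conePow ε n))

lemma CompatibleRetracts.map {D : Type u} [Category.{v} D] [Preadditive D] {D' : Type u'}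
    [Category.{v'} D'] [Preadditive D'] (G : D ⥤ D') [G.Additive]
    {X : ℕ → ChainComplex D ℕ} {φ : ∀ n, X n ⟶ X (n + 1)}
    {M : ChainComplex D ℕ} {r : ∀ n, TruncRetract M (X n) n} (hr : CompatibleRetracts φ r) :
    CompatibleRetracts (fun n => (G.mapHomologicalComplex _).map (φ n))
      (fun n => (r n).map G) where
  φ_π n k := (G.map_comp _ _).symm.trans (congrArg G.map (hr.φ_π n k))
  χ_φ n k hk := (G.map_comp _ _).symm.trans (congrArg G.map (hr.χ_φ n k hk))
  φ_h n k := (G.map_comp _ _).symm.trans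
    ((congrArg G.map (hr.φ_h n k)).trans (G.map_comp _ _))

lemma hEquiv_conePowInfty_normalizedComplex (h : RightCounitAxiom ε Δ) {B : Type u'}
    [Category.{v'} B] [Preadditive B] [HasFiniteBiproducts B] [HasCountableCoproducts B]
    (G : A ⥤ B) [G.Additive] :
    HEquiv (toKar (conePowInfty ε G)) (karMap G (normalizedComplex h)) := by
  let T := (telescopeData (fun n => (G.mapHomologicalComplex _).map (conePowMap ε n))).toKar
  let T' := T.ofIso (fun n => (karMapToKarIso G).app (conePow ε n))
    (fun n => (karMapToKarIso G).hom.naturality (conePowMap ε n))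
  exact T'.hEquiv ((compatibleRetracts_conePow h).map ((functorExtension₂ A B).obj G))

end ConePowers

/-! ### Comparison of relative resolutions -/

section Comparison

variable {D : Type u} [Category.{v} D] [Preadditive D]

/-- The complex of abelian groups `Hom(Z, K)` is exact: any morphism to `K 0`, and any morphism
`Z ⟶ K (k + 1)` killed by the differential, factors through the differential. -/
structure HomExact (Z : D) (K : ChainComplex D ℕ) : Prop where
  exists_lift_zero : ∀ f : Z ⟶ K.X 0, ∃ g : Z ⟶ K.X 1, g ≫ K.d 1 0 = f
  exists_lift_succ : ∀ (k : ℕ) (f : Z ⟶ K.X (k + 1)), f ≫ K.d (k + 1) k = 0 →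
    ∃ g : Z ⟶ K.X (k + 2), g ≫ K.d (k + 2) (k + 1) = f

variable {M N : ChainComplex D ℕ}

/-- A morphism in degree zero extends to a morphism of complexes. -/
lemma exists_hom_extending (hMN : ∀ k, HomExact (M.X (k + 1)) N) (f₀ : M.X 0 ⟶ N.X 0) :
    ∃ f : M ⟶ N, f.f 0 = f₀ := by
  obtain ⟨f₁, hf₁⟩ := (hMN 0).exists_lift_zero (M.d 1 0 ≫ f₀)
  -- The data passed on by the recursion principle `ChainComplex.mkHom` are two consecutive
  -- components of the morphism together with their commutation relation.
  have step : ∀ (n : ℕ) (p : Σ' (f : M.X n ⟶ N.X n) (f' : M.X (n + 1) ⟶ N.X (n + 1)),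
      f' ≫ N.d (n + 1) n = M.d (n + 1) n ≫ f),
      ∃ f'' : M.X (n + 2) ⟶ N.X (n + 2), f'' ≫ N.d (n + 2) (n + 1) = M.d (n + 2) (n + 1) ≫ p.2.1 :=
    fun n p => (hMN (n + 1)).exists_lift_succ n _ (by
      rw [Category.assoc, p.2.2, M.d_comp_d_assoc, zero_comp])
  exact ⟨ChainComplex.mkHom M N f₀ f₁ hf₁ fun n p =>
    ⟨(step n p).choose, (step n p).choose_spec⟩, by simp⟩

/-- A morphism of complexes that vanishes in degree zero is homotopic to zero. -/
lemma nonempty_homotopy_zero (hMN : ∀ k, HomExact (M.X (k + 1)) N) (f : M ⟶ N)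
    (hf : f.f 0 = 0) : Nonempty (Homotopy f 0) := by
  obtain ⟨s, hs⟩ := (hMN 0).exists_lift_succ 0 (f.f 1) (by rw [f.comm, hf, comp_zero])
  have step : ∀ (n : ℕ) (p : Σ' (g : M.X n ⟶ N.X (n + 1)) (g' : M.X (n + 1) ⟶ N.X (n + 2)),
      f.f (n + 1) = M.d (n + 1) n ≫ g + g' ≫ N.d (n + 2) (n + 1)),
      ∃ g'' : M.X (n + 2) ⟶ N.X (n + 3),
        g'' ≫ N.d (n + 3) (n + 2) = f.f (n + 2) - M.d (n + 2) (n + 1) ≫ p.2.1 :=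
    fun n p => (hMN (n + 1)).exists_lift_succ (n + 1) _ (by
      have hp := congrArg (M.d (n + 2) (n + 1) ≫ ·) p.2.2
      simp only [Preadditive.comp_add, M.d_comp_d_assoc, zero_comp, zero_add] at hp
      rw [Preadditive.sub_comp, f.comm, Category.assoc]
      exact sub_eq_zero.2 hp)
  exact ⟨Homotopy.mkInductive f 0 (by rw [hf, zero_comp]) s (by rw [hs, comp_zero, zero_add])
    fun n p => ⟨(step n p).choose, by rw [(step n p).choose_spec, add_sub_cancel]⟩⟩

/-- Two complexes with isomorphic terms in degree zero are homotopy equivalent if `Hom(Z, -)` of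
either of them is exact for each of their terms `Z` in positive degrees. -/
lemma hEquiv_of_homExact (hMM : ∀ k, HomExact (M.X (k + 1)) M)
    (hMN : ∀ k, HomExact (M.X (k + 1)) N) (hNM : ∀ k, HomExact (N.X (k + 1)) M)
    (hNN : ∀ k, HomExact (N.X (k + 1)) N) (i : M.X 0 ≅ N.X 0) : HEquiv M N := by
  obtain ⟨f, hf⟩ := exists_hom_extending hMN i.hom
  obtain ⟨g, hg⟩ := exists_hom_extending hNM i.inv
  obtain ⟨s⟩ := nonempty_homotopy_zero hMM (f ≫ g - 𝟙 M) (by simp [hf, hg])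
  obtain ⟨t⟩ := nonempty_homotopy_zero hNN (g ≫ f - 𝟙 N) (by simp [hf, hg])
  exact ⟨⟨f, g, Homotopy.equivSubZero.symm s, Homotopy.equivSubZero.symm t⟩⟩

end Comparison

/-! ### The complexes `A_C` and `Â_C` for a counital object -/

section Counital

variable {A : Type u} [Category.{v} A] [Preadditive A] [MonoidalCategory A]
  [MonoidalPreadditive A] {C : A} {ε : C ⟶ 𝟙_ A} {Δ : C ⟶ C ⊗ C}

omit [Preadditive A] [MonoidalPreadditive A] in
/-- A section `s` of `ε ⋆ id_C` induces sections of `ε ⋆ id` on all objects `C ⋆ Y`. -/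
lemma comultLeft_whiskerLeft_counitLeft {s : C ⟶ C ⊗ C} (hs : s ≫ counitLeft ε C = 𝟙 C) {Y Z : A}
    (x : C ⊗ Y ⟶ Z) : comultLeft s Y ≫ (C ◁ x) ≫ counitLeft ε Z = x := by
  have h1 : comultLeft s Y ≫ counitLeft ε (C ⊗ Y) = 𝟙 _ := by
    have : (α_ C C Y).hom ≫ counitLeft ε (C ⊗ Y) = counitLeft ε C ▷ Y := by
      simp [counitLeft]
    rw [comultLeft, Category.assoc, this, ← comp_whiskerRight, hs, id_whiskerRight]
  rw [whiskerLeft_counitLeft, reassoc_of% h1]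

lemma barComplex_d (k : ℕ) : (barComplex ε).d (k + 1) k = barD ε k :=
  ChainComplex.of_d (pow C) (barD ε) k

/-- In degree `k + 1` a lift of `f` is `± (id_C ⋆ f) ∘ (s ⋆ id)`: composing with `ε` in the first
position gives back `f`, and the alternating sum over the other positions vanishes since `f` is a
cycle. -/
lemma homExact_barComplex {s : C ⟶ C ⊗ C} (hs : s ≫ counitLeft ε C = 𝟙 C) {Y : A}
    (p : C ⊗ Y ⟶ C ⊗ Y) (hp : p ≫ p = p) : HomExact ⟨C ⊗ Y, p, hp⟩ (toKar (barComplex ε)) := by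
  have hd : ∀ k, ((toKar (barComplex ε)).d (k + 1) k).f = barD ε k := barComplex_d
  refine ⟨fun f => ⟨⟨p ≫ comultLeft s Y ≫ (C ◁ f.f), ?_⟩, Karoubi.hom_ext _ _ ?_⟩,
    fun k f hf => ⟨⟨-(p ≫ comultLeft s Y ≫ (C ◁ f.f)), ?_⟩, Karoubi.hom_ext _ _ ?_⟩⟩
  · exact (congrArg (p ≫ ·) (Category.comp_id _)).trans (by rw [reassoc_of% hp])
  · rw [Karoubi.comp_f, hd]
    have h0 : barD ε 0 = counitLeft ε (𝟙_ A) := by simp [barD, altSum, counitAt]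
    rw [h0]
    refine (Category.assoc _ _ _).trans ?_
    erw [Category.assoc, comultLeft_whiskerLeft_counitLeft hs f.f]
    exact Karoubi.p_comp f
  · exact (congrArg (p ≫ ·) (Category.comp_id _)).trans ((Preadditive.comp_neg _ _).trans
      (congrArg Neg.neg ((Category.assoc _ _ _).symm.trans
        (congrArg (· ≫ comultLeft s _ ≫ (C ◁ f.f)) hp))))
  · have hf' : f.f ≫ altSum ε k = 0 := by
      have := congrArg Karoubi.Hom.f hf
      rw [Karoubi.comp_f, hd] at this
      cases k with
      | zero => exact this
      | succ k =>
        have h' : -(f.f ≫ altSum ε (k + 1)) = 0 := (Preadditive.comp_neg _ _).symm.trans this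
        exact neg_eq_zero.1 h'
    rw [Karoubi.comp_f, hd]
    have h1 : (C ◁ f.f) ≫ altSum ε (k + 1) = (C ◁ f.f) ≫ counitLeft ε (pow C (k + 1)) := by
      rw [altSum_succ]
      refine (Preadditive.comp_sub _ _ _).trans ?_
      have : (C ◁ f.f) ≫ (C ◁ altSum ε k) = 0 := by
        refine (MonoidalCategory.whiskerLeft_comp _ _ _).symm.trans ?_
        rw [hf', MonoidalPreadditive.whiskerLeft_zero]
      exact (congrArg _ this).trans (sub_zero _)
    have h2 : (p ≫ comultLeft s Y ≫ (C ◁ f.f)) ≫ altSum ε (k + 1) = f.f := by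
      refine (Category.assoc _ _ _).trans ?_
      erw [Category.assoc, h1, comultLeft_whiskerLeft_counitLeft hs f.f]
      exact Karoubi.p_comp f
    exact (Preadditive.neg_comp_neg _ _).trans h2

/-- A lift of `f` is `(id_C ⋆ f) ∘ (s ⋆ id)`; it is fixed by the idempotent `e_{k+2}` because it is
annihilated by `ε` in all positions but the first. -/
lemma homExact_normalizedComplex (h : RightCounitAxiom ε Δ) {s : C ⟶ C ⊗ C}
    (hs : s ≫ counitLeft ε C = 𝟙 C) {Y : A}
    (p : C ⊗ Y ⟶ C ⊗ Y) (hp : p ≫ p = p) : HomExact ⟨C ⊗ Y, p, hp⟩ (normalizedComplex h) := by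
  have key : ∀ (k : ℕ) (x : C ⊗ Y ⟶ pow C k)
      (hx : (p ≫ comultLeft s Y ≫ (C ◁ x)) ≫ e ε Δ (k + 1) = p ≫ comultLeft s Y ≫ (C ◁ x)),
      (p ≫ comultLeft s Y ≫ (C ◁ x)) ≫ delta ε Δ k = p ≫ x := fun k x hx => by
    rw [delta, ← Category.assoc, hx, counitAt_zero, Category.assoc, Category.assoc,
      comultLeft_whiskerLeft_counitLeft hs]
  have lift : ∀ (k : ℕ) (f : (⟨C ⊗ Y, p, hp⟩ : Karoubi A) ⟶ imE h k)
      (hf : (p ≫ comultLeft s Y ≫ (C ◁ f.f)) ≫ e ε Δ (k + 1) = p ≫ comultLeft s Y ≫ (C ◁ f.f)),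
      ∃ g : (⟨C ⊗ Y, p, hp⟩ : Karoubi A) ⟶ imE h (k + 1),
        g ≫ (normalizedComplex h).d (k + 1) k = f := fun k f hf => by
    refine ⟨⟨p ≫ comultLeft s Y ≫ (C ◁ f.f), ?_⟩, Karoubi.hom_ext _ _ ?_⟩
    · exact (congrArg (p ≫ ·) hf).trans ((Category.assoc _ _ _).symm.trans
        (congrArg (· ≫ comultLeft s _ ≫ (C ◁ f.f)) hp))
    · exact (congrArg ((p ≫ comultLeft s _ ≫ (C ◁ f.f)) ≫ ·) (normalizedComplex_d_f h k)).trans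
        ((key k f.f hf).trans (Karoubi.p_comp f))
  refine ⟨fun f => lift 0 f (Category.comp_id _), fun k f hf => lift (k + 1) f ?_⟩
  have hf0 : f.f ≫ delta ε Δ k = 0 := by
    have := congrArg Karoubi.Hom.f hf
    rwa [Karoubi.comp_f, normalizedComplex_d_f] at this
  have he : f.f ≫ e ε Δ (k + 1) = f.f := Karoubi.comp_p f
  -- The morphism `f` is annihilated by `ε` in the first position since it is a cycle, and in the
  -- other positions since it factors through the image of `e_{k+1}`.
  have hall : ∀ j, f.f ≫ counitAt ε k j = 0 := by
    refine Fin.cases ?_ fun j => ?_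
    · rw [← he]
      exact (Category.assoc _ _ _).trans hf0
    · cases k with
      | zero => exact j.elim0
      | succ k =>
        rw [← he]
        exact (Category.assoc _ _ _).trans
          ((congrArg (f.f ≫ ·) (e_comp_counitAt h k j)).trans comp_zero)
  refine absorb (k + 1) _ fun j => ?_
  rw [counitAt_succ]
  have : (C ◁ f.f) ≫ (C ◁ counitAt ε k j) = 0 := by
    refine (MonoidalCategory.whiskerLeft_comp _ _ _).symm.trans ?_
    rw [hall, MonoidalPreadditive.whiskerLeft_zero]
  refine (Category.assoc _ _ _).trans ?_
  erw [Category.assoc, this]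
  simp

/-- Both complexes are resolutions of the unit, relative to the objects `C ⋆ Y`. -/
lemma hEquiv_barComplex_normalizedComplex (h : RightCounitAxiom ε Δ) (hε : IsCounit ε) :
    HEquiv (toKar (barComplex ε)) (normalizedComplex h) := by
  obtain ⟨⟨r⟩⟩ := hε.2
  have hs : ((λ_ C).inv ≫ r.section_) ≫ counitLeft ε C = 𝟙 C := by
    rw [counitLeft, Category.assoc, r.id_assoc, Iso.inv_hom_id]
  exact hEquiv_of_homExact
    (fun k => homExact_barComplex hs (Y := pow C k) (𝟙 _) (Category.comp_id _))
    (fun k => homExact_normalizedComplex h hs (Y := pow C k) (𝟙 _) (Category.comp_id _))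
    (fun k => homExact_barComplex hs (Y := pow C k) (e ε Δ (k + 1)) (e_idem h (k + 1)))
    (fun k => homExact_normalizedComplex h hs (Y := pow C k) (e ε Δ (k + 1)) (e_idem h (k + 1)))
    (Iso.refl ((toKaroubi A).obj (𝟙_ A)))

end Counital

/-! ### Homotopy equivalences over the Karoubi envelope -/

section Reflection

variable {D : Type u} [Category.{v} D] [Preadditive D]

lemma HEquiv.symm {K L : ChainComplex D ℕ} (h : HEquiv K L) : HEquiv L K :=
  ⟨h.some.symm⟩

lemma HEquiv.trans {K L N : ChainComplex D ℕ} (h : HEquiv K L) (h' : HEquiv L N) : HEquiv K N :=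
  ⟨h.some.trans h'.some⟩

lemma HEquiv.of_iso {K L : ChainComplex D ℕ} (i : K ≅ L) : HEquiv K L :=
  ⟨HomotopyEquiv.ofIso i⟩

lemma HEquiv.map {D' : Type u'} [Category.{v'} D'] [Preadditive D'] (G : D ⥤ D') [G.Additive]
    {K L : ChainComplex D ℕ} (h : HEquiv K L) :
    HEquiv ((G.mapHomologicalComplex _).obj K) ((G.mapHomologicalComplex _).obj L) :=
  ⟨G.mapHomotopyEquiv h.some⟩

/-- A morphism of complexes over the Karoubi envelope, between complexes over `D`. -/
def ofKarHom {K L : ChainComplex D ℕ} (f : toKar K ⟶ toKar L) : K ⟶ L where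
  f k := (f.f k).f
  comm' i j _ := congrArg Karoubi.Hom.f (f.comm i j)

/-- A homotopy over the Karoubi envelope, between morphisms of complexes over `D`. -/
def ofKarHomotopy {K L : ChainComplex D ℕ} {f g : K ⟶ L}
    (H : Homotopy (((toKaroubi D).mapHomologicalComplex _).map f)
      (((toKaroubi D).mapHomologicalComplex _).map g)) : Homotopy f g where
  hom i j := (H.hom i j).f
  zero i j hij := congrArg Karoubi.Hom.f (H.zero i j hij)
  comm i := congrArg Karoubi.Hom.f (H.comm i)

/-- A homotopy equivalence over the Karoubi envelope between complexes over `D` comes from a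
homotopy equivalence over `D`. -/
lemma hEquiv_of_toKar {K L : ChainComplex D ℕ} (h : HEquiv (toKar K) (toKar L)) : HEquiv K L := by
  obtain ⟨h⟩ := h
  exact ⟨⟨ofKarHom h.hom, ofKarHom h.inv, ofKarHomotopy h.homotopyHomInvId,
    ofKarHomotopy h.homotopyInvHomId⟩⟩

end Reflection

end CounitalPowers

end

open CounitalPowers

theorem mainTheorem4 {A : Type u} [Category.{v} A] [Preadditive A] [HasFiniteBiproducts A]
    [MonoidalCategory A] [MonoidalPreadditive A]
    (C : A) (ε : C ⟶ 𝟙_ A) (Δ : C ⟶ C ⊗ C) (h : RightCounitAxiom ε Δ) :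
    (∀ n : ℕ, HEquiv (toKar (conePow ε n)) (truncatedComplex h n)) ∧
    (∀ {B : Type u'} [Category.{v'} B] [Preadditive B] [HasFiniteBiproducts B]
      [HasCountableCoproducts B] (G : A ⥤ B) [G.Additive],
      HEquiv (toKar (conePowInfty ε G)) (karMap G (normalizedComplex h))) ∧
    (IsCounit ε →
      HEquiv (toKar (barComplex ε)) (normalizedComplex h) ∧
      ∀ {B : Type u'} [Category.{v'} B] [Preadditive B] [HasFiniteBiproducts B]
        [HasCountableCoproducts B] (G : A ⥤ B) [G.Additive],
        HEquiv (conePowInfty ε G) ((G.mapHomologicalComplex _).obj (barComplex ε))) := by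
  refine ⟨hEquiv_conePow_truncatedComplex h,
    fun G _ => hEquiv_conePowInfty_normalizedComplex h G, fun hε =>
    ⟨hEquiv_barComplex_normalizedComplex h hε, fun {B} _ _ _ _ G _ => hEquiv_of_toKar ?_⟩⟩
  exact ((hEquiv_conePowInfty_normalizedComplex h G).trans
    ((hEquiv_barComplex_normalizedComplex h hε).map ((functorExtension₂ A B).obj G)).symm).trans
    (.of_iso ((karMapToKarIso G).app (barComplex ε)))
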